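/- \textbf{Setting.} Let $\mathcal V$ be a uniformly discrete subset of the plane $\{x_3=0\}$ in $\mathbb R^3$ and $\mathcal E\subset\mathcal V\times\mathcal V$ a set of directed edges. For $e=(\alpha,\beta)\in\mathcal E$ put $l_e=|\beta-\alpha|$ and $\mathbf e_e=(\beta-\alpha)/l_e$, and assume $0<\inf_e l_e\le\sup_e l_e<\infty$. Assume that the number of edges starting at $\alpha$ plus the number of edges ending at $\alpha$ lies between $1$ and some $N$ independent of $\alpha$, for all $\alpha\in\mathcal V$. Let $U_e\in L^2([0,l_e],\mathbb R)$ with $\sup_e\|U_e\|_{L^2}<\infty$, $\mathbf A\in C^1(\mathbb R^3,\mathbb R^3)$, $k_R\in\mathbb R$, and $\epsilon:\mathcal V\to\mathbb R$ an arbitrary function. Set $a_e(t)=\langle \mathbf A(\alpha+t\mathbf e_e),\mathbf e_e\rangle$ and \[ \sigma_e=\begin{pmatrix}0&\mathbf e_{e,2}+i\mathbf e_{e,1}\\ \mathbf e_{e,2}-i\mathbf e_{e,1}&0\end{pmatrix},\qquad L_e=\Big(i\frac{d}{dt}+a_e+k_R\sigma_e\Big)^2+U_e-k_R^2,\qquad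 \nabla_e=\frac{d}{dt}-i(a_e+k_R\sigma_e). \] Let $\mathcal H=\bigoplus_{e\in\mathcal E}L^2([0,l_e],\mathbb C^2)$ (Hilbert direct sum). Let $\mathcal D$ be the set of all $f=(f_e)\in\mathcal H$ such that $f_e\in H^2([0,l_e],\mathbb C^2)$ for every $e$, $(L_ef_e)_e\in\mathcal H$, and $f$ is continuous at the nodes: for each $\alpha\in\mathcal V$ there is a vector $f(\alpha)\in\mathbb C^2$ with $f_e(0)=f(\alpha)$ for every edge $e$ starting at $\alpha$ and $f_e(l_e)=f(\alpha)$ for every edge $e$ ending at $\alpha$. Let $\Pi$ be the operator in $\mathcal H$ with domain $\mathcal D$ and $\Pi f=(L_ef_e)_e$. For $f\in\mathcal D$ put \[ f'(\alpha)=\sum_{e\text{ starting at }\alpha}(\nabla_ef_e)(0)-\sum_{e\text{ ending at }\alpha}(\nabla_ef_e)(l_e),\qquad \Gamma f=(f(\alpha))_{\alpha\in\mathcal V},\quad \Gamma'f=(f'(\alpha))_{\alpha\in\mathcal V}. \] Let $L$ be the restriction of $\Pi$ to those $f\in\mathcal D$ with $f'(\alpha)=\epsilon(\alpha)f(\alpha)$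 for all $\alpha\in\mathcal V$. \textbf{Proposition.} (1) The operator $\Pi$ is closed. (2) For every $f\in\mathcal D$ the families $\Gamma f$ and $\Gamma'f$ belong to $\ell^2(\mathcal V,\mathbb C^2)$. The map $(\Gamma,\Gamma'):\mathcal D\to\ell^2(\mathcal V,\mathbb C^2)\oplus\ell^2(\mathcal V,\mathbb C^2)$ is surjective with kernel dense in $\mathcal H$, and for all $f,g\in\mathcal D$ \[ \langle f,\Pi g\rangle-\langle\Pi f,g\rangle=\langle\Gamma f,\Gamma'g\rangle-\langle\Gamma'f,\Gamma g\rangle . \] Thus $(\ell^2(\mathcal V,\mathbb C^2),\Gamma,\Gamma')$ is a boundary triple for $\Pi$. (3) The spin-orbit Hamiltonian $L$ is (densely defined and) self-adjoint in $\mathcal H$. -/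

import Mathlib

open MeasureTheory Set
open scoped ENNReal

noncomputable section

/-- Three-dimensional Euclidean space. -/
abbrev R3 := EuclideanSpace ℝ (Fin 3)

/-- The spin space `ℂ²`. -/
abbrev Spin := EuclideanSpace ℂ (Fin 2)

/-- Lebesgue measure on the segment `[0,l]`. -/
abbrev segMeasure (l : ℝ) : Measure ℝ := volume.restrict (Icc 0 l)

/-- `L²([0,l],ℂ²)`. -/
abbrev SegL2 (l : ℝ) := Lp Spin 2 (segMeasure l)

/-! ### The Sobolev space `H²([0,l],ℂ²)` -/

/-- `f` is the `C¹` representative of `u ∈ L²([0,l],ℂ²)`, `f'` is its derivative on `[0,l]`, `f'` is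
absolutely continuous, and `f'' ∈ L²` is the (a.e. and weak) derivative of `f'`. -/
structure IsH2Rep (l : ℝ) (u : SegL2 l) (f f' f'' : ℝ → Spin) : Prop where
  ae_eq : u =ᵐ[segMeasure l] f
  memLp : MemLp f'' 2 (segMeasure l)
  deriv_eq : ∀ t ∈ Icc 0 l, f' t = f' 0 + ∫ s in (0 : ℝ)..t, f'' s
  eq : ∀ t ∈ Icc 0 l, f t = f 0 + ∫ s in (0 : ℝ)..t, f' s

/-- `u` belongs to `H²([0,l],ℂ²)`. -/
def IsH2 (l : ℝ) (u : SegL2 l) : Prop :=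
  ∃ p : (ℝ → Spin) × (ℝ → Spin) × (ℝ → Spin), IsH2Rep l u p.1 p.2.1 p.2.2

open Classical in
/-- The triple `(f, f', f'')` attached to `u ∈ H²([0,l],ℂ²)` (and zero if `u ∉ H²`). On `[0,l]`, `f` and
`f'` are uniquely determined by `u`, and `f''` is uniquely determined almost everywhere. -/
def h2Rep (l : ℝ) (u : SegL2 l) : (ℝ → Spin) × (ℝ → Spin) × (ℝ → Spin) :=
  if h : IsH2 l u then h.choose else 0

/-- The `C¹` representative of `u ∈ H²`. -/
def h2Val (l : ℝ) (u : SegL2 l) : ℝ → Spin := (h2Rep l u).1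

/-- The first derivative of `u ∈ H²`. -/
def h2D1 (l : ℝ) (u : SegL2 l) : ℝ → Spin := (h2Rep l u).2.1

/-- The second derivative of `u ∈ H²`. -/
def h2D2 (l : ℝ) (u : SegL2 l) : ℝ → Spin := (h2Rep l u).2.2

theorem IsH2.rep {l : ℝ} {u : SegL2 l} (h : IsH2 l u) :
    IsH2Rep l u (h2Val l u) (h2D1 l u) (h2D2 l u) := by
  have := h.choose_spec
  simpa only [h2Val, h2D1, h2D2, h2Rep, dif_pos h] using this

theorem IsH2Rep.isH2 {l : ℝ} {u : SegL2 l} {f f' f'' : ℝ → Spin} (h : IsH2Rep l u f f' f'') :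
    IsH2 l u := ⟨(f, f', f''), h⟩

theorem intervalIntegrable_of_seg {l t : ℝ} (ht : t ∈ Icc 0 l) {f : ℝ → Spin}
    (hf : IntegrableOn f (Icc 0 l)) : IntervalIntegrable f volume 0 t := by
  rw [intervalIntegrable_iff_integrableOn_Icc_of_le ht.1]
  exact hf.mono_set (Icc_subset_Icc_right ht.2)

theorem continuousOn_of_primitive {l : ℝ} {f g : ℝ → Spin} (hg : IntegrableOn g (Icc 0 l))
    (h : ∀ t ∈ Icc 0 l, f t = f 0 + ∫ s in (0 : ℝ)..t, g s) : ContinuousOn f (Icc 0 l) := by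
  rcases le_or_gt 0 l with hl | hl
  · have h2 := intervalIntegral.continuousOn_primitive_interval (μ := volume) (f := g) (a := 0) (b := l)
      (by rwa [uIcc_of_le hl])
    rw [uIcc_of_le hl] at h2
    exact (continuousOn_const.add h2).congr h
  · simp [Icc_eq_empty_of_lt hl]

theorem IsH2Rep.int2 {l : ℝ} {u : SegL2 l} {f f' f'' : ℝ → Spin} (h : IsH2Rep l u f f' f'') :
    IntegrableOn f'' (Icc 0 l) := h.memLp.integrable (by norm_num)

theorem IsH2Rep.cont1 {l : ℝ} {u : SegL2 l} {f f' f'' : ℝ → Spin} (h : IsH2Rep l u f f' f'') :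
    ContinuousOn f' (Icc 0 l) := continuousOn_of_primitive h.int2 h.deriv_eq

theorem IsH2Rep.int1 {l : ℝ} {u : SegL2 l} {f f' f'' : ℝ → Spin} (h : IsH2Rep l u f f' f'') :
    IntegrableOn f' (Icc 0 l) := h.cont1.integrableOn_Icc

theorem IsH2Rep.cont {l : ℝ} {u : SegL2 l} {f f' f'' : ℝ → Spin} (h : IsH2Rep l u f f' f'') :
    ContinuousOn f (Icc 0 l) := continuousOn_of_primitive h.int1 h.eq

theorem IsH2Rep.add {l : ℝ} {u v : SegL2 l} {f f' f'' g g' g'' : ℝ → Spin}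
    (h : IsH2Rep l u f f' f'') (k : IsH2Rep l v g g' g'') :
    IsH2Rep l (u + v) (f + g) (f' + g') (f'' + g'') where
  ae_eq := (Lp.coeFn_add u v).trans (h.ae_eq.add k.ae_eq)
  memLp := h.memLp.add k.memLp
  deriv_eq t ht := by
    simp only [Pi.add_apply]
    rw [intervalIntegral.integral_add (intervalIntegrable_of_seg ht h.int2)
      (intervalIntegrable_of_seg ht k.int2), h.deriv_eq t ht, k.deriv_eq t ht]
    abel
  eq t ht := by
    simp only [Pi.add_apply]
    rw [intervalIntegral.integral_add (intervalIntegrable_of_seg ht h.int1)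
      (intervalIntegrable_of_seg ht k.int1), h.eq t ht, k.eq t ht]
    abel

theorem IsH2Rep.smul {l : ℝ} {u : SegL2 l} {f f' f'' : ℝ → Spin} (c : ℂ)
    (h : IsH2Rep l u f f' f'') : IsH2Rep l (c • u) (c • f) (c • f') (c • f'') where
  ae_eq := (Lp.coeFn_smul c u).trans (h.ae_eq.const_smul c)
  memLp := h.memLp.const_smul c
  deriv_eq t ht := by
    simp only [Pi.smul_apply]
    rw [intervalIntegral.integral_smul, h.deriv_eq t ht, smul_add]
  eq t ht := by
    simp only [Pi.smul_apply]
    rw [intervalIntegral.integral_smul, h.eq t ht, smul_add]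

theorem IsH2Rep.zero (l : ℝ) : IsH2Rep l 0 0 0 0 where
  ae_eq := Lp.coeFn_zero _ _ _
  memLp := MemLp.zero
  deriv_eq t _ := by simp
  eq t _ := by simp

theorem ae_zero_of_primitive_zero {l : ℝ} (hl : 0 < l) {g : ℝ → Spin} (hg : IntegrableOn g (Icc 0 l))
    (h : ∀ t ∈ Icc 0 l, ∫ s in (0 : ℝ)..t, g s = 0) : g =ᵐ[segMeasure l] 0 := by
  have hi := intervalIntegrable_of_seg (right_mem_Icc.2 hl.le) hg
  have h1 := hi.ae_hasDerivAt_integral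
  rw [segMeasure, Measure.restrict_congr_set Ioo_ae_eq_Icc.symm]
  rw [Filter.EventuallyEq, ae_restrict_iff' measurableSet_Ioo]
  filter_upwards [h1] with x hx hxl
  have hx' := hx (by rw [uIcc_of_le hl.le]; exact Ioo_subset_Icc_self hxl) 0
    (by rw [uIcc_of_le hl.le]; exact left_mem_Icc.2 hl.le)
  have h0 : HasDerivAt (fun y => ∫ s in (0 : ℝ)..y, g s) 0 x := by
    refine (hasDerivAt_const x (0 : Spin)).congr_of_eventuallyEq ?_
    filter_upwards [Ioo_mem_nhds hxl.1 hxl.2] with y hy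
    exact h y (Ioo_subset_Icc_self hy)
  exact hx'.unique h0

theorem eq_zero_of_ae {l : ℝ} (hl : 0 < l) {f : ℝ → Spin} (hf : ContinuousOn f (Icc 0 l))
    (h : f =ᵐ[segMeasure l] 0) : ∀ t ∈ Icc 0 l, f t = 0 :=
  Measure.eqOn_Icc_of_ae_eq volume hl.ne h hf continuousOn_const

theorem IsH2Rep.eq_zero {l : ℝ} (hl : 0 < l) {f f' f'' : ℝ → Spin} (h : IsH2Rep l 0 f f' f'') :
    (∀ t ∈ Icc 0 l, f t = 0) ∧ (∀ t ∈ Icc 0 l, f' t = 0) ∧ f'' =ᵐ[segMeasure l] 0 := by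
  have h0 : (0 : ℝ) ∈ Icc 0 l := left_mem_Icc.2 hl.le
  have hf := eq_zero_of_ae hl h.cont (h.ae_eq.symm.trans (Lp.coeFn_zero _ _ _))
  have hf' := eq_zero_of_ae hl h.cont1 (ae_zero_of_primitive_zero hl h.int1 fun t ht => by
    simpa [hf t ht, hf 0 h0] using (h.eq t ht).symm)
  exact ⟨hf, hf', ae_zero_of_primitive_zero hl h.int2 fun t ht => by
    simpa [hf' t ht, hf' 0 h0] using (h.deriv_eq t ht).symm⟩

/-- The representative and its derivatives are determined by the element of `L²`. -/
theorem IsH2Rep.unique {l : ℝ} (hl : 0 < l) {u : SegL2 l} {f f' f'' g g' g'' : ℝ → Spin}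
    (h : IsH2Rep l u f f' f'') (k : IsH2Rep l u g g' g'') :
    (∀ t ∈ Icc 0 l, f t = g t) ∧ (∀ t ∈ Icc 0 l, f' t = g' t) ∧ f'' =ᵐ[segMeasure l] g'' := by
  have hk := h.add (k.smul (-1))
  rw [neg_one_smul, add_neg_cancel] at hk
  obtain ⟨h1, h2, h3⟩ := hk.eq_zero hl
  refine ⟨fun t ht => ?_, fun t ht => ?_, ?_⟩
  · have := h1 t ht
    simp only [neg_smul, one_smul, Pi.add_apply, Pi.neg_apply] at this
    exact add_neg_eq_zero.1 this
  · have := h2 t ht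
    simp only [neg_smul, one_smul, Pi.add_apply, Pi.neg_apply] at this
    exact add_neg_eq_zero.1 this
  · filter_upwards [h3] with t this
    simp only [neg_smul, one_smul, Pi.add_apply, Pi.neg_apply, Pi.zero_apply] at this
    exact add_neg_eq_zero.1 this

/-! ### The network -/

/-- A quantum network in the plane with magnetic field and Rashba spin-orbit interaction: the data
and the standing assumptions. -/
structure RashbaNetwork where
  /-- The nodes. -/
  vert : Set R3
  vert_plane : ∀ v ∈ vert, v 2 = 0
  vert_discrete : ∃ d : ℝ, 0 < d ∧ ∀ v ∈ vert, ∀ w ∈ vert, v ≠ w → d ≤ dist v w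
  /-- The directed edges. -/
  edge : Set (R3 × R3)
  edge_subset : edge ⊆ vert ×ˢ vert
  /-- The degrees (indegree plus outdegree) are positive and bounded. -/
  degree_bound : ∃ N : ℕ, ∀ v ∈ vert,
    1 ≤ {w | (w, v) ∈ edge}.encard + {w | (v, w) ∈ edge}.encard ∧
      {w | (w, v) ∈ edge}.encard + {w | (v, w) ∈ edge}.encard ≤ (N : ℕ∞)
  /-- The edge lengths are bounded away from zero and bounded. -/
  length_lower : ∃ c : ℝ, 0 < c ∧ ∀ e ∈ edge, c ≤ dist e.1 e.2
  length_upper : ∃ C : ℝ, ∀ e ∈ edge, dist e.1 e.2 ≤ C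
  /-- The scalar potentials on the edges. -/
  U : edge → ℝ → ℝ
  U_memLp : ∀ e : edge, MemLp (U e) 2 (segMeasure (dist e.1.1 e.1.2))
  U_bound : ∃ C : NNReal, ∀ e : edge, eLpNorm (U e) 2 (segMeasure (dist e.1.1 e.1.2)) ≤ C
  /-- The magnetic vector potential. -/
  A : R3 → R3
  A_contDiff : ContDiff ℝ 1 A
  /-- The Rashba constant. -/
  kR : ℝ
  /-- The coupling constants at the nodes. -/
  eps : vert → ℝ

namespace RashbaNetwork

variable (N : RashbaNetwork)

/-- The initial vertex of an edge. -/
def src (e : N.edge) : N.vert := ⟨e.1.1, (N.edge_subset e.2).1⟩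

/-- The terminal vertex of an edge. -/
def tgt (e : N.edge) : N.vert := ⟨e.1.2, (N.edge_subset e.2).2⟩

/-- The length of an edge. -/
abbrev len (e : N.edge) : ℝ := dist e.1.1 e.1.2

theorem len_pos (e : N.edge) : 0 < N.len e := by
  obtain ⟨c, hc, h⟩ := N.length_lower
  exact hc.trans_le (h e.1 e.2)

/-- The unit vector along an edge. -/
def dir (e : N.edge) : R3 := (N.len e)⁻¹ • (e.1.2 - e.1.1)

/-- The magnetic potential on an edge: the component of the vector potential along it. -/
def a (e : N.edge) (t : ℝ) : ℝ := inner ℝ (N.A (e.1.1 + t • N.dir e)) (N.dir e)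

/-- The spin matrix of an edge, as a linear map in `ℂ²`. -/
def spinMat (e : N.edge) : Spin →ₗ[ℂ] Spin :=
  Matrix.toEuclideanLin
    !![0, ((N.dir e 1 : ℝ) : ℂ) + Complex.I * ((N.dir e 0 : ℝ) : ℂ);
      ((N.dir e 1 : ℝ) : ℂ) - Complex.I * ((N.dir e 0 : ℝ) : ℂ), 0]

/-- `(i d/dt + a + k_R σ) f`, given `f` and its derivative `f'`. -/
def momentum (e : N.edge) (f f' : ℝ → Spin) (t : ℝ) : Spin :=
  Complex.I • f' t + (N.a e t : ℂ) • f t + (N.kR : ℂ) • N.spinMat e (f t)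

/-- The derivative of `momentum e f f'`, given also the second derivative `f''`. -/
def momentumDeriv (e : N.edge) (f f' f'' : ℝ → Spin) (t : ℝ) : Spin :=
  Complex.I • f'' t + (((deriv (N.a e) t : ℝ) : ℂ) • f t + (N.a e t : ℂ) • f' t)
    + (N.kR : ℂ) • N.spinMat e (f' t)

/-- The differential expression `(i d/dt + a + k_R σ)² f + U f - k_R² f` on an edge. -/
def edgeExpr (e : N.edge) (f f' f'' : ℝ → Spin) (t : ℝ) : Spin :=
  N.momentum e (N.momentum e f f') (N.momentumDeriv e f f' f'') t
    + (N.U e t : ℂ) • f t - ((N.kR : ℂ) ^ 2) • f t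

/-- `[d/dt - i (a + k_R σ)] f`, given `f` and its derivative `f'`. -/
def covDeriv (e : N.edge) (f f' : ℝ → Spin) (t : ℝ) : Spin :=
  f' t - Complex.I • ((N.a e t : ℂ) • f t + (N.kR : ℂ) • N.spinMat e (f t))

/-- The state space: the Hilbert direct sum over all edges of `L²([0,l_e],ℂ²)`. -/
abbrev StateSpace := lp (fun e : N.edge => SegL2 (N.len e)) 2

/-- The space `ℓ²(V,ℂ²)`. -/
abbrev NodeSpace := lp (fun _ : N.vert => Spin) 2

/-- The expression `L_e f_e` for an `H²` component `f_e`. -/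
def edgeOp (f : N.StateSpace) (e : N.edge) : ℝ → Spin :=
  N.edgeExpr e (h2Val _ (f e)) (h2D1 _ (f e)) (h2D2 _ (f e))

/-- `φ` gives the node values of `f`: at each node, all edge components have the value prescribed
by `φ`. Such a `φ` exists if and only if `f` is continuous at all nodes. -/
def IsNodeValues (f : N.StateSpace) (φ : N.vert → Spin) : Prop :=
  ∀ e, h2Val _ (f e) 0 = φ (N.src e) ∧ h2Val _ (f e) (N.len e) = φ (N.tgt e)

/-- The domain of the maximal operator: all components are in `H²`, the function obtained by
applying the differential expressions edgewise is in the state space, and `f` is continuous at all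
nodes. -/
structure MemDomain (f : N.StateSpace) : Prop where
  isH2 : ∀ e, IsH2 _ (f e)
  image : ∃ g : N.StateSpace, ∀ e, g e =ᵐ[segMeasure (N.len e)] N.edgeOp f e
  continuous : ∃ φ, N.IsNodeValues f φ

variable {N}

theorem val_add {l : ℝ} (hl : 0 < l) {u v : SegL2 l} (hu : IsH2 l u) (hv : IsH2 l v) :
    (∀ t ∈ Icc 0 l, h2Val l (u + v) t = h2Val l u t + h2Val l v t) ∧
    (∀ t ∈ Icc 0 l, h2D1 l (u + v) t = h2D1 l u t + h2D1 l v t) ∧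
    h2D2 l (u + v) =ᵐ[segMeasure l] h2D2 l u + h2D2 l v :=
  ((hu.rep.add hv.rep).isH2.rep).unique hl (hu.rep.add hv.rep)

theorem val_smul {l : ℝ} (hl : 0 < l) {u : SegL2 l} (c : ℂ) (hu : IsH2 l u) :
    (∀ t ∈ Icc 0 l, h2Val l (c • u) t = c • h2Val l u t) ∧
    (∀ t ∈ Icc 0 l, h2D1 l (c • u) t = c • h2D1 l u t) ∧
    h2D2 l (c • u) =ᵐ[segMeasure l] c • h2D2 l u :=
  ((hu.rep.smul c).isH2.rep).unique hl (hu.rep.smul c)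

theorem edgeOp_add {f g : N.StateSpace} (e : N.edge) (hf : IsH2 _ (f e)) (hg : IsH2 _ (g e)) :
    N.edgeOp (f + g) e =ᵐ[segMeasure (N.len e)] N.edgeOp f e + N.edgeOp g e := by
  obtain ⟨h1, h2, h3⟩ := val_add (N.len_pos e) hf hg
  filter_upwards [h3, ae_restrict_mem measurableSet_Icc] with t ht hI
  simp only [edgeOp, edgeExpr, momentum, momentumDeriv, lp.coeFn_add, Pi.add_apply, h1 t hI,
    h2 t hI, ht, smul_add, map_add]
  abel

theorem edgeOp_smul {f : N.StateSpace} (c : ℂ) (e : N.edge) (hf : IsH2 _ (f e)) :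
    N.edgeOp (c • f) e =ᵐ[segMeasure (N.len e)] c • N.edgeOp f e := by
  obtain ⟨h1, h2, h3⟩ := val_smul (N.len_pos e) c hf
  filter_upwards [h3, ae_restrict_mem measurableSet_Icc] with t ht hI
  simp only [edgeOp, edgeExpr, momentum, momentumDeriv, lp.coeFn_smul, Pi.smul_apply, h1 t hI,
    h2 t hI, ht, smul_add, map_add, map_smul, smul_sub, smul_comm _ c]

theorem IsNodeValues.add {f g : N.StateSpace} {φ ψ : N.vert → Spin}
    (hf : ∀ e, IsH2 _ (f e)) (hg : ∀ e, IsH2 _ (g e))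
    (h : N.IsNodeValues f φ) (k : N.IsNodeValues g ψ) : N.IsNodeValues (f + g) (φ + ψ) := by
  intro e
  obtain ⟨h1, -, -⟩ := val_add (N.len_pos e) (hf e) (hg e)
  have hl := (N.len_pos e).le
  simp only [lp.coeFn_add, Pi.add_apply]
  rw [h1 _ (left_mem_Icc.2 hl), h1 _ (right_mem_Icc.2 hl), (h e).1, (h e).2, (k e).1, (k e).2]
  exact ⟨rfl, rfl⟩

theorem IsNodeValues.smul {f : N.StateSpace} {φ : N.vert → Spin} (c : ℂ)
    (hf : ∀ e, IsH2 _ (f e)) (h : N.IsNodeValues f φ) : N.IsNodeValues (c • f) (c • φ) := by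
  intro e
  obtain ⟨h1, -, -⟩ := val_smul (N.len_pos e) c (hf e)
  have hl := (N.len_pos e).le
  simp only [lp.coeFn_smul, Pi.smul_apply]
  rw [h1 _ (left_mem_Icc.2 hl), h1 _ (right_mem_Icc.2 hl), (h e).1, (h e).2]
  exact ⟨rfl, rfl⟩

/-- Node values are unique because every node has an edge. -/
theorem IsNodeValues.unique {f : N.StateSpace} {φ ψ : N.vert → Spin}
    (h : N.IsNodeValues f φ) (k : N.IsNodeValues f ψ) : φ = ψ := by
  funext v
  obtain ⟨M, hM⟩ := N.degree_bound
  have h1 := (hM v v.2).1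
  by_cases hin : {w | (w, v.1) ∈ N.edge} = ∅
  · have hout : {w | (v.1, w) ∈ N.edge}.encard ≠ 0 := by
      intro h0
      rw [hin, h0] at h1
      simp at h1
    obtain ⟨w, hw⟩ := Set.encard_ne_zero.1 hout
    exact ((h ⟨(v.1, w), hw⟩).1).symm.trans ((k ⟨(v.1, w), hw⟩).1)
  · obtain ⟨w, hw⟩ := Set.nonempty_iff_ne_empty.2 hin
    exact ((h ⟨(w, v.1), hw⟩).2).symm.trans ((k ⟨(w, v.1), hw⟩).2)

theorem MemDomain.add {f g : N.StateSpace} (hf : N.MemDomain f) (hg : N.MemDomain g) :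
    N.MemDomain (f + g) where
  isH2 e := ((hf.isH2 e).rep.add (hg.isH2 e).rep).isH2
  image := by
    obtain ⟨p, hp⟩ := hf.image
    obtain ⟨q, hq⟩ := hg.image
    exact ⟨p + q, fun e => ((Lp.coeFn_add _ _).trans ((hp e).add (hq e))).trans
      (edgeOp_add e (hf.isH2 e) (hg.isH2 e)).symm⟩
  continuous := by
    obtain ⟨φ, hφ⟩ := hf.continuous
    obtain ⟨ψ, hψ⟩ := hg.continuous
    exact ⟨φ + ψ, hφ.add hf.isH2 hg.isH2 hψ⟩

theorem MemDomain.smul {f : N.StateSpace} (c : ℂ) (hf : N.MemDomain f) : N.MemDomain (c • f) where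
  isH2 e := ((hf.isH2 e).rep.smul c).isH2
  image := by
    obtain ⟨p, hp⟩ := hf.image
    exact ⟨c • p, fun e => ((Lp.coeFn_smul _ _).trans ((hp e).const_smul c)).trans
      (edgeOp_smul c e (hf.isH2 e)).symm⟩
  continuous := by
    obtain ⟨φ, hφ⟩ := hf.continuous
    exact ⟨c • φ, hφ.smul c hf.isH2⟩

theorem edgeOp_zero (e : N.edge) : N.edgeOp 0 e =ᵐ[segMeasure (N.len e)] 0 := by
  have := edgeOp_smul (f := (0 : N.StateSpace)) 0 e (IsH2Rep.zero _).isH2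
  simpa using this

theorem MemDomain.zero : N.MemDomain 0 where
  isH2 _ := (IsH2Rep.zero _).isH2
  image := ⟨0, fun e => (Lp.coeFn_zero _ _ _).trans (edgeOp_zero e).symm⟩
  continuous := ⟨0, fun e => by
    have h := ((IsH2Rep.zero (N.len e)).isH2.rep.unique (N.len_pos e) (IsH2Rep.zero _)).1
    exact ⟨h _ (left_mem_Icc.2 (N.len_pos e).le), h _ (right_mem_Icc.2 (N.len_pos e).le)⟩⟩

theorem state_ext {f g : N.StateSpace} {F : N.edge → ℝ → Spin}
    (hf : ∀ e, f e =ᵐ[segMeasure (N.len e)] F e) (hg : ∀ e, g e =ᵐ[segMeasure (N.len e)] F e) :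
    f = g := by
  ext1
  funext e
  exact Lp.ext ((hf e).trans (hg e).symm)

variable (N)

/-- The domain `𝒟` as a subspace of the state space. -/
def dom : Submodule ℂ N.StateSpace where
  carrier := {f | N.MemDomain f}
  add_mem' := MemDomain.add
  zero_mem' := MemDomain.zero
  smul_mem' c _ := MemDomain.smul c

/-- The maximal operator `Π`: it acts on each edge by the differential expression. -/
def maxOp : N.StateSpace →ₗ.[ℂ] N.StateSpace where
  domain := N.dom
  toFun :=
    { toFun := fun f => f.2.image.choose
      map_add' := fun f g => state_ext (f.2.add g.2).image.choose_spec fun e =>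
        ((Lp.coeFn_add _ _).trans ((f.2.image.choose_spec e).add (g.2.image.choose_spec e))).trans
          (edgeOp_add e (f.2.isH2 e) (g.2.isH2 e)).symm
      map_smul' := fun c f => state_ext (f.2.smul c).image.choose_spec fun e =>
        ((Lp.coeFn_smul _ _).trans ((f.2.image.choose_spec e).const_smul c)).trans
          (edgeOp_smul c e (f.2.isH2 e)).symm }

theorem maxOp_spec (f : N.maxOp.domain) (e : N.edge) :
    (N.maxOp f) e =ᵐ[segMeasure (N.len e)] N.edgeOp f e := f.2.image.choose_spec e

/-- The node values `f(α)` of `f ∈ 𝒟`. -/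
def nodeVal : N.dom →ₗ[ℂ] (N.vert → Spin) where
  toFun f := f.2.continuous.choose
  map_add' f g := IsNodeValues.unique (f.2.add g.2).continuous.choose_spec
    (f.2.continuous.choose_spec.add f.2.isH2 g.2.isH2 g.2.continuous.choose_spec)
  map_smul' c f := IsNodeValues.unique (f.2.smul c).continuous.choose_spec
    (f.2.continuous.choose_spec.smul c f.2.isH2)

theorem nodeVal_spec (f : N.dom) : N.IsNodeValues f (N.nodeVal f) := f.2.continuous.choose_spec

variable {N}

theorem finite_src (v : N.vert) : {e : N.edge | N.src e = v}.Finite := by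
  obtain ⟨M, hM⟩ := N.degree_bound
  have h1 : {w | (v.1, w) ∈ N.edge}.Finite :=
    Set.finite_of_encard_le_coe (le_add_self.trans (hM v v.2).2)
  refine Set.Finite.of_finite_image (f := fun e : N.edge => e.1.2) (h1.subset ?_) ?_
  · rintro _ ⟨e, rfl, rfl⟩
    exact e.2
  · intro e he e' he' h
    exact Subtype.ext (Prod.ext (congrArg Subtype.val (he.trans he'.symm)) h)

theorem finite_tgt (v : N.vert) : {e : N.edge | N.tgt e = v}.Finite := by
  obtain ⟨M, hM⟩ := N.degree_bound
  have h1 : {w | (w, v.1) ∈ N.edge}.Finite :=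
    Set.finite_of_encard_le_coe (le_self_add.trans (hM v v.2).2)
  refine Set.Finite.of_finite_image (f := fun e : N.edge => e.1.1) (h1.subset ?_) ?_
  · rintro _ ⟨e, rfl, rfl⟩
    exact e.2
  · intro e he e' he' h
    exact Subtype.ext (Prod.ext h (congrArg Subtype.val (he.trans he'.symm)))

variable (N)

/-- The covariant derivative `[d/dt - i (a + k_R σ)] f_e (t)` of an edge component. -/
def edgeCov (f : N.StateSpace) (e : N.edge) : ℝ → Spin :=
  N.covDeriv e (h2Val _ (f e)) (h2D1 _ (f e))

variable {N}

theorem edgeCov_add {f g : N.StateSpace} (e : N.edge) (hf : IsH2 _ (f e)) (hg : IsH2 _ (g e)) :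
    ∀ t ∈ Icc 0 (N.len e), N.edgeCov (f + g) e t = N.edgeCov f e t + N.edgeCov g e t := by
  intro t hI
  obtain ⟨h1, h2, -⟩ := val_add (N.len_pos e) hf hg
  simp only [edgeCov, covDeriv, lp.coeFn_add, Pi.add_apply, h1 t hI, h2 t hI, smul_add, map_add]
  abel

theorem edgeCov_smul {f : N.StateSpace} (c : ℂ) (e : N.edge) (hf : IsH2 _ (f e)) :
    ∀ t ∈ Icc 0 (N.len e), N.edgeCov (c • f) e t = c • N.edgeCov f e t := by
  intro t hI
  obtain ⟨h1, h2, -⟩ := val_smul (N.len_pos e) c hf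
  simp only [edgeCov, covDeriv, lp.coeFn_smul, Pi.smul_apply, h1 t hI, h2 t hI, smul_add, map_smul,
    smul_sub, smul_comm _ c]

variable (N)

/-- The node derivatives `f'(α)` of `f ∈ 𝒟`: the sum of the covariant derivatives at the node over
the outgoing edges minus the sum over the incoming edges. Both sums are finite. -/
def nodeDeriv : N.dom →ₗ[ℂ] (N.vert → Spin) where
  toFun f v := (∑ᶠ e ∈ {e : N.edge | N.src e = v}, N.edgeCov f e 0)
    - ∑ᶠ e ∈ {e : N.edge | N.tgt e = v}, N.edgeCov f e (N.len e)
  map_add' f g := by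
    funext v
    simp only [Submodule.coe_add, Pi.add_apply]
    rw [finsum_mem_congr rfl fun e _ => edgeCov_add e (f.2.isH2 e) (g.2.isH2 e) 0
        (left_mem_Icc.2 (N.len_pos e).le),
      finsum_mem_congr rfl fun e _ => edgeCov_add e (f.2.isH2 e) (g.2.isH2 e) (N.len e)
        (right_mem_Icc.2 (N.len_pos e).le),
      finsum_mem_add_distrib (finite_src v), finsum_mem_add_distrib (finite_tgt v)]
    abel
  map_smul' c f := by
    funext v
    simp only [Submodule.coe_smul, Pi.smul_apply, RingHom.id_apply]
    rw [finsum_mem_congr rfl fun e _ => edgeCov_smul c e (f.2.isH2 e) 0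
        (left_mem_Icc.2 (N.len_pos e).le),
      finsum_mem_congr rfl fun e _ => edgeCov_smul c e (f.2.isH2 e) (N.len e)
        (right_mem_Icc.2 (N.len_pos e).le),
      smul_sub, smul_finsum_mem (finite_src v), smul_finsum_mem (finite_tgt v)]

/-- The functions in `𝒟` satisfying the vertex conditions `f'(α) = ε(α) f(α)` at all nodes. -/
def hamiltonianDom : Submodule ℂ N.StateSpace :=
  Submodule.map N.dom.subtype
    { carrier := {f | ∀ v, N.nodeDeriv f v = (N.eps v : ℂ) • N.nodeVal f v}
      add_mem' := fun {f g} hf hg v => by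
        simp only [map_add, Pi.add_apply, hf v, hg v, smul_add]
      zero_mem' := fun v => by simp
      smul_mem' := fun c f hf v => by
        simp only [map_smul, Pi.smul_apply, hf v, smul_comm c] }

/-- The magnetic Rashba (spin-orbit) Hamiltonian: the restriction of the maximal operator to the
functions satisfying the vertex conditions. -/
def hamiltonian : N.StateSpace →ₗ.[ℂ] N.StateSpace := N.maxOp.domRestrict N.hamiltonianDom

end RashbaNetwork

/-- `(G, Γ, Γ')` is a boundary triple for the operator `T`: `T` is closed, the abstract Green identity
holds, `(Γ, Γ')` maps the domain of `T` onto `G ⊕ G`, and its kernel is dense. -/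
structure IsBoundaryTriple {H G : Type*} [NormedAddCommGroup H] [InnerProductSpace ℂ H]
    [NormedAddCommGroup G] [InnerProductSpace ℂ G] (T : H →ₗ.[ℂ] H)
    (Γ Γ' : T.domain →ₗ[ℂ] G) : Prop where
  closed : T.IsClosed
  green : ∀ f g : T.domain, inner ℂ (f : H) (T g) - inner ℂ (T f) (g : H)
    = inner ℂ (Γ f) (Γ' g) - inner ℂ (Γ' f) (Γ g)
  surjective : Function.Surjective fun f : T.domain => (Γ f, Γ' f)
  dense_ker : Dense {x : H | ∃ f : T.domain, (f : H) = x ∧ Γ f = 0 ∧ Γ' f = 0}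

end

/-!
A unitary gauge transformation `exp (i ∫ a_e) exp (i k_R t σ_e)` turns `L_e` into
`u ↦ -u'' + (U_e - k_R²) u`, because `σ_e` is constant and hermitian. As the edge lengths and
`‖U_e‖` are controlled uniformly, every prescription of boundary data on an edge extends to the edge
with a constant independent of `e`, by a cubic polynomial in the gauged picture. Green's identity
against a suitable such extension bounds the boundary data of any function on the edge, again
uniformly. Together with the bound on the degrees, this shows that `Γ` and `Γ'` take values in `ℓ²`
and are jointly surjective.

Green's identity for `Π` is the sum of those on the edges, regrouped by nodes. Testing against
functions supported on one edge or on two edges with a common node shows that the adjoint of the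
restriction of `Π` to `ker Γ ∩ ker Γ'` is contained in `Π`, hence equal to it. Being an adjoint, `Π`
is closed, and since this adjoint is single-valued the common kernel is dense. The vertex conditions
say that `(Γ f, Γ' f)` lies in the graph of multiplication by `ε`, a self-adjoint relation in `ℓ²`,
and Green's identity carries this self-adjointness over to `L`.
-/
open MeasureTheory Set
open scoped ENNReal

noncomputable section

/-! ### Absolutely continuous functions on a segment -/

section Primitive

theorem intervalIntegrable_of_mem_Icc {E : Type*} [NormedAddCommGroup E] {l t : ℝ} {f : ℝ → E}
    (ht : t ∈ Icc 0 l) (hf : IntegrableOn f (Icc 0 l)) : IntervalIntegrable f volume 0 t := by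
  rw [intervalIntegrable_iff_integrableOn_Icc_of_le ht.1]
  exact hf.mono_set (Icc_subset_Icc_right ht.2)

variable {E F G : Type*} [NormedAddCommGroup E] [NormedSpace ℝ E]
  [NormedAddCommGroup F] [NormedSpace ℝ F] [NormedAddCommGroup G] [NormedSpace ℝ G]
  {l : ℝ} {f f' f₁ f₁' : ℝ → E} {g g' : ℝ → F}

theorem absolutelyContinuousOnInterval_of_dist_le {X Y Z : Type*} [PseudoMetricSpace X]
    [PseudoMetricSpace Y] [PseudoMetricSpace Z] {h : ℝ → Z} {f : ℝ → X} {g : ℝ → Y} {a b : ℝ}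
    (c d : ℝ) (hf : AbsolutelyContinuousOnInterval f a b)
    (hg : AbsolutelyContinuousOnInterval g a b)
    (hle : ∀ x ∈ uIcc a b, ∀ y ∈ uIcc a b,
      dist (h x) (h y) ≤ c * dist (f x) (f y) + d * dist (g x) (g y)) :
    AbsolutelyContinuousOnInterval h a b := by
  have hlim := (Filter.Tendsto.const_mul c hf).add (Filter.Tendsto.const_mul d hg)
  rw [mul_zero, mul_zero, add_zero] at hlim
  refine squeeze_zero' (.of_forall fun _ => Finset.sum_nonneg fun _ _ => dist_nonneg) ?_ hlim
  filter_upwards [Filter.mem_inf_of_right (Filter.mem_principal_self _)] with I hI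
  rw [Finset.mul_sum, Finset.mul_sum, ← Finset.sum_add_distrib]
  exact Finset.sum_le_sum fun i hi => hle _ (hI.1 i hi).1 _ (hI.1 i hi).2

theorem absolutelyContinuousOnInterval_integral [CompleteSpace E] {a b : ℝ}
    (hf : IntervalIntegrable f volume a b) :
    AbsolutelyContinuousOnInterval (fun t => ∫ s in a..t, f s) a b := by
  have hnorm := hf.norm.absolutelyContinuousOnInterval_intervalIntegral left_mem_uIcc
  refine absolutelyContinuousOnInterval_of_dist_le 1 0 hnorm hnorm fun x hx y hy => ?_
  have hsub : ∀ z ∈ uIcc a b, IntervalIntegrable f volume a z := fun z hz =>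
    hf.mono_set (uIcc_subset_uIcc_left hz)
  rw [one_mul, zero_mul, add_zero, dist_eq_norm, dist_eq_norm,
    intervalIntegral.integral_interval_sub_left (hsub x hx) (hsub y hy),
    intervalIntegral.integral_interval_sub_left (hsub x hx).norm (hsub y hy).norm]
  exact intervalIntegral.norm_integral_le_abs_integral_norm

/-- `f` is absolutely continuous on `[0,l]` with integrable derivative `f'`. -/
structure IsPrimitive (l : ℝ) (f f' : ℝ → E) : Prop where
  integrableOn : IntegrableOn f' (Icc 0 l)
  eq : ∀ t ∈ Icc 0 l, f t = f 0 + ∫ s in (0 : ℝ)..t, f' s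

namespace IsPrimitive

theorem of_hasDerivAt [CompleteSpace E] (h : ∀ t, HasDerivAt f (f' t) t)
    (hf' : Continuous f') (l : ℝ) : IsPrimitive l f f' where
  integrableOn := hf'.continuousOn.integrableOn_Icc
  eq t _ := by
    rw [intervalIntegral.integral_eq_sub_of_hasDerivAt (fun s _ => h s)
      (hf'.intervalIntegrable _ _), add_sub_cancel]

theorem intervalIntegrable (h : IsPrimitive l f f') {t : ℝ} (ht : t ∈ Icc 0 l) :
    IntervalIntegrable f' volume 0 t :=
  intervalIntegrable_of_mem_Icc ht h.integrableOn

theorem integral_eq_sub (h : IsPrimitive l f f') {t : ℝ} (ht : t ∈ Icc 0 l) :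
    ∫ s in (0 : ℝ)..t, f' s = f t - f 0 := by
  rw [h.eq t ht, add_sub_cancel_left]

theorem absolutelyContinuousOnInterval [CompleteSpace E] (hl : 0 ≤ l) (h : IsPrimitive l f f') :
    AbsolutelyContinuousOnInterval f 0 l := by
  have hint := absolutelyContinuousOnInterval_integral (h.intervalIntegrable (right_mem_Icc.2 hl))
  refine absolutelyContinuousOnInterval_of_dist_le 1 0 hint hint fun x hx y hy => ?_
  rw [uIcc_of_le hl] at hx hy
  rw [h.eq x hx, h.eq y hy, dist_add_left, one_mul, zero_mul, add_zero]

theorem ae_hasDerivAt [CompleteSpace E] (hl : 0 ≤ l) (h : IsPrimitive l f f') :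
    ∀ᵐ t, t ∈ Ioo 0 l → HasDerivAt f (f' t) t := by
  filter_upwards [(h.intervalIntegrable (right_mem_Icc.2 hl)).ae_hasDerivAt_integral]
    with t hderiv ht
  rw [uIcc_of_le hl] at hderiv
  refine ((hderiv (Ioo_subset_Icc_self ht) 0 (left_mem_Icc.2 hl)).const_add
    (f 0)).congr_of_eventuallyEq ?_
  filter_upwards [Ioo_mem_nhds ht.1 ht.2] with s hs using h.eq s (Ioo_subset_Icc_self hs)

theorem of_ae_hasDerivAt [CompleteSpace E] (hl : 0 ≤ l)
    (hf : AbsolutelyContinuousOnInterval f 0 l) (hf' : IntegrableOn f' (Icc 0 l))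
    (h : ∀ᵐ t, t ∈ Ioo 0 l → HasDerivAt f (f' t) t) : IsPrimitive l f f' := by
  refine ⟨hf', fun t ht => ?_⟩
  have hint := intervalIntegrable_of_mem_Icc (right_mem_Icc.2 hl) hf'
  have hconst : ∃ C, ∀ x ∈ uIcc 0 l, f x - ∫ s in (0 : ℝ)..x, f' s = C := by
    refine (hf.sub (absolutelyContinuousOnInterval_integral hint)).const_of_ae_hasDerivAt_zero ?_
    filter_upwards [h, hint.ae_hasDerivAt_integral, Ioo_ae_eq_Icc (a := 0) (b := l) (μ := volume)]
      with x hfx hintx hmem hx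
    have hxl : x ∈ Ioo 0 l := by rw [← uIcc_of_le hl] at hmem; exact hmem.mpr hx
    exact (hfx hxl).sub (hintx hx 0 left_mem_uIcc) |>.congr_deriv (sub_self _)
  obtain ⟨C, hC⟩ := hconst
  rw [uIcc_of_le hl] at hC
  have h0 := hC 0 (left_mem_Icc.2 hl)
  rw [intervalIntegral.integral_same, sub_zero] at h0
  rw [h0, ← hC t ht, sub_add_cancel]

theorem continuousOn [CompleteSpace E] (h : IsPrimitive l f f') : ContinuousOn f (Icc 0 l) := by
  rcases le_or_gt 0 l with hl | hl
  · simpa only [uIcc_of_le hl] using (h.absolutelyContinuousOnInterval hl).continuousOn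
  · simp only [Icc_eq_empty_of_lt hl, continuousOn_empty]

theorem add (h : IsPrimitive l f f') (h₁ : IsPrimitive l f₁ f₁') :
    IsPrimitive l (fun t => f t + f₁ t) (fun t => f' t + f₁' t) where
  integrableOn := h.integrableOn.add h₁.integrableOn
  eq t ht := by
    rw [intervalIntegral.integral_add (h.intervalIntegrable ht) (h₁.intervalIntegrable ht),
      h.eq t ht, h₁.eq t ht]
    abel

theorem clm_apply [CompleteSpace E] [CompleteSpace F] (L : E →L[ℝ] F) (h : IsPrimitive l f f') :
    IsPrimitive l (fun t => L (f t)) (fun t => L (f' t)) where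
  integrableOn := L.integrable_comp h.integrableOn
  eq t ht := by
    rw [L.intervalIntegral_comp_comm (h.intervalIntegrable ht), h.eq t ht, map_add]

theorem congr (h : IsPrimitive l f f') (hf : ∀ t ∈ Icc 0 l, f₁ t = f t)
    (hf' : f₁' =ᵐ[segMeasure l] f') : IsPrimitive l f₁ f₁' where
  integrableOn := h.integrableOn.congr hf'.symm
  eq t ht := by
    rw [hf t ht, hf 0 (left_mem_Icc.2 (ht.1.trans ht.2)), h.eq t ht]
    refine congrArg _ (intervalIntegral.integral_congr_ae ?_)
    rw [uIoc_of_le ht.1]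
    filter_upwards [(ae_restrict_iff' measurableSet_Icc).1 hf'] with s hs hst
    exact (hs ⟨hst.1.le, hst.2.trans ht.2⟩).symm

theorem setIntegral_eq_sub (hl : 0 ≤ l) (h : IsPrimitive l f f') :
    ∫ t, f' t ∂segMeasure l = f l - f 0 := by
  rw [← h.integral_eq_sub (right_mem_Icc.2 hl), intervalIntegral.integral_of_le hl,
    integral_Icc_eq_integral_Ioc]

theorem integral (hf : IntegrableOn f (Icc 0 l)) :
    IsPrimitive l (fun t => ∫ s in (0 : ℝ)..t, f s) f where
  integrableOn := hf
  eq t _ := by rw [intervalIntegral.integral_same, zero_add]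

end IsPrimitive

theorem integrableOn_bilin_continuousOn (B : E →L[ℝ] F →L[ℝ] G)
    (hf : IntegrableOn f (Icc 0 l)) (hg : ContinuousOn g (Icc 0 l)) :
    IntegrableOn (fun t => B (f t) (g t)) (Icc 0 l) := by
  obtain ⟨C, hC⟩ := isCompact_Icc.exists_bound_of_continuousOn hg
  refine Integrable.mono' (g := fun t => ‖B‖ * ‖f t‖ * C) ((hf.norm.const_mul _).mul_const _)
    (B.aestronglyMeasurable_comp₂ hf.aestronglyMeasurable
      (hg.aestronglyMeasurable measurableSet_Icc)) ?_
  filter_upwards [ae_restrict_mem measurableSet_Icc] with t ht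
  exact (B.le_opNorm₂ _ _).trans (mul_le_mul_of_nonneg_left (hC t ht) (by positivity))

theorem absolutelyContinuousOnInterval_bilin (B : E →L[ℝ] F →L[ℝ] G) {a b : ℝ}
    (hf : AbsolutelyContinuousOnInterval f a b) (hg : AbsolutelyContinuousOnInterval g a b) :
    AbsolutelyContinuousOnInterval (fun t => B (f t) (g t)) a b := by
  obtain ⟨C, hC⟩ := hf.exists_bound
  obtain ⟨D, hD⟩ := hg.exists_bound
  refine absolutelyContinuousOnInterval_of_dist_le (‖B‖ * D) (‖B‖ * C) hf hg fun x hx y hy => ?_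
  have hsplit : B (f x) (g x) - B (f y) (g y) = B (f x - f y) (g x) + B (f y) (g x - g y) := by
    simp only [map_sub, sub_apply, sub_add_sub_cancel]
  simp only [dist_eq_norm, hsplit]
  calc ‖B (f x - f y) (g x) + B (f y) (g x - g y)‖
      ≤ ‖B‖ * ‖f x - f y‖ * ‖g x‖ + ‖B‖ * ‖f y‖ * ‖g x - g y‖ :=
        norm_add_le_of_le (B.le_opNorm₂ _ _) (B.le_opNorm₂ _ _)
    _ ≤ ‖B‖ * ‖f x - f y‖ * D + ‖B‖ * C * ‖g x - g y‖ := by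
        gcongr
        · exact hD x hx
        · exact hC y hy
    _ = ‖B‖ * D * ‖f x - f y‖ + ‖B‖ * C * ‖g x - g y‖ := by ring

theorem IsPrimitive.bilin [CompleteSpace E] [CompleteSpace F] [CompleteSpace G]
    (B : E →L[ℝ] F →L[ℝ] G) (hl : 0 ≤ l) (hf : IsPrimitive l f f') (hg : IsPrimitive l g g') :
    IsPrimitive l (fun t => B (f t) (g t)) (fun t => B (f' t) (g t) + B (f t) (g' t)) := by
  refine of_ae_hasDerivAt hl (absolutelyContinuousOnInterval_bilin B
    (hf.absolutelyContinuousOnInterval hl) (hg.absolutelyContinuousOnInterval hl)) ?_ ?_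
  · exact (integrableOn_bilin_continuousOn B hf.integrableOn hg.continuousOn).add
      (integrableOn_bilin_continuousOn B.flip hg.integrableOn hf.continuousOn)
  · filter_upwards [hf.ae_hasDerivAt hl, hg.ae_hasDerivAt hl] with t hft hgt ht
    exact (B.hasFDerivAt_of_bilinear (hft ht).hasFDerivAt (hgt ht).hasFDerivAt).hasDerivAt
      |>.congr_deriv (by simp [add_comm])

end Primitive

/-! ### Cubic Hermite interpolation -/

section Hermite

variable {E : Type*} [NormedAddCommGroup E] [NormedSpace ℝ E]

/-- The cubic polynomial `u` with `u 0 = x₀`, `u l = x₁`, `u' 0 = y₀` and `u' l = y₁`, written in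
the Hermite basis so that its coefficients are bounded on `[0,l]`. -/
def hermite (l : ℝ) (x₀ x₁ y₀ y₁ : E) (t : ℝ) : E :=
  (2 * (t / l) ^ 3 - 3 * (t / l) ^ 2 + 1) • x₀ + (3 * (t / l) ^ 2 - 2 * (t / l) ^ 3) • x₁
    + (l * ((t / l) ^ 3 - 2 * (t / l) ^ 2 + t / l)) • y₀
    + (l * ((t / l) ^ 3 - (t / l) ^ 2)) • y₁

/-- The first derivative of `hermite`. -/
def hermiteD1 (l : ℝ) (x₀ x₁ y₀ y₁ : E) (t : ℝ) : E :=
  ((6 * (t / l) ^ 2 - 6 * (t / l)) / l) • x₀ + ((6 * (t / l) - 6 * (t / l) ^ 2) / l) • x₁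
    + (3 * (t / l) ^ 2 - 4 * (t / l) + 1) • y₀ + (3 * (t / l) ^ 2 - 2 * (t / l)) • y₁

/-- The second derivative of `hermite`. -/
def hermiteD2 (l : ℝ) (x₀ x₁ y₀ y₁ : E) (t : ℝ) : E :=
  ((12 * (t / l) - 6) / l ^ 2) • x₀ + ((6 - 12 * (t / l)) / l ^ 2) • x₁
    + ((6 * (t / l) - 4) / l) • y₀ + ((6 * (t / l) - 2) / l) • y₁

variable {l : ℝ}

theorem hasDerivAt_hermite (hl : l ≠ 0) (x₀ x₁ y₀ y₁ : E) (t : ℝ) :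
    HasDerivAt (hermite l x₀ x₁ y₀ y₁) (hermiteD1 l x₀ x₁ y₀ y₁ t) t := by
  have hs : HasDerivAt (fun t : ℝ => t / l) (1 / l) t := (hasDerivAt_id t).div_const l
  have h₀ := (((hs.pow 3).const_mul 2).sub ((hs.pow 2).const_mul 3)).add_const 1
  have h₁ := ((hs.pow 2).const_mul 3).sub ((hs.pow 3).const_mul 2)
  have k₀ := (((hs.pow 3).sub ((hs.pow 2).const_mul 2)).add hs).const_mul l
  have k₁ := ((hs.pow 3).sub (hs.pow 2)).const_mul l
  refine ((((h₀.smul_const x₀).add (h₁.smul_const x₁)).add (k₀.smul_const y₀)).add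
    (k₁.smul_const y₁)).congr_deriv ?_
  rw [hermiteD1]
  congr 4 <;> push_cast <;> field_simp <;> ring

theorem hasDerivAt_hermiteD1 (hl : l ≠ 0) (x₀ x₁ y₀ y₁ : E) (t : ℝ) :
    HasDerivAt (hermiteD1 l x₀ x₁ y₀ y₁) (hermiteD2 l x₀ x₁ y₀ y₁ t) t := by
  have hs : HasDerivAt (fun t : ℝ => t / l) (1 / l) t := (hasDerivAt_id t).div_const l
  have h₀ := (((hs.pow 2).const_mul 6).sub (hs.const_mul 6)).div_const l
  have h₁ := ((hs.const_mul 6).sub ((hs.pow 2).const_mul 6)).div_const l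
  have k₀ := (((hs.pow 2).const_mul 3).sub (hs.const_mul 4)).add_const 1
  have k₁ := ((hs.pow 2).const_mul 3).sub (hs.const_mul 2)
  refine ((((h₀.smul_const x₀).add (h₁.smul_const x₁)).add (k₀.smul_const y₀)).add
    (k₁.smul_const y₁)).congr_deriv ?_
  rw [hermiteD2]
  congr 4 <;> push_cast <;> field_simp <;> ring

theorem continuous_hermiteD2 (x₀ x₁ y₀ y₁ : E) : Continuous (hermiteD2 l x₀ x₁ y₀ y₁) := by
  unfold hermiteD2
  fun_prop

theorem hermiteD2_eq_affine (x₀ x₁ y₀ y₁ : E) :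
    ∃ x v : E, ∀ t, hermiteD2 l x₀ x₁ y₀ y₁ t = x + t • v := by
  refine ⟨hermiteD2 l x₀ x₁ y₀ y₁ 0,
    (12 / l ^ 3) • (x₀ - x₁) + (6 / l ^ 2) • (y₀ + y₁), fun t => ?_⟩
  simp only [hermiteD2, smul_sub, smul_add, smul_smul]
  match_scalars <;> ring

theorem hermite_zero (x₀ x₁ y₀ y₁ : E) : hermite l x₀ x₁ y₀ y₁ 0 = x₀ := by
  simp [hermite]

theorem hermite_right (hl : l ≠ 0) (x₀ x₁ y₀ y₁ : E) : hermite l x₀ x₁ y₀ y₁ l = x₁ := by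
  rw [hermite, div_self hl]
  module

theorem hermiteD1_zero (x₀ x₁ y₀ y₁ : E) : hermiteD1 l x₀ x₁ y₀ y₁ 0 = y₀ := by
  simp [hermiteD1]

theorem hermiteD1_right (hl : l ≠ 0) (x₀ x₁ y₀ y₁ : E) : hermiteD1 l x₀ x₁ y₀ y₁ l = y₁ := by
  rw [hermiteD1, div_self hl]
  module

theorem norm_add_four_smul_le {a b c d K : ℝ} (ha : |a| ≤ K) (hb : |b| ≤ K) (hc : |c| ≤ K)
    (hd : |d| ≤ K) (x₀ x₁ y₀ y₁ : E) :
    ‖a • x₀ + b • x₁ + c • y₀ + d • y₁‖ ≤ K * (‖x₀‖ + ‖x₁‖ + ‖y₀‖ + ‖y₁‖) := by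
  refine norm_add₄_le.trans ?_
  simp only [norm_smul, Real.norm_eq_abs, mul_add]
  gcongr

theorem norm_hermite_le (x₀ x₁ y₀ y₁ : E) {t : ℝ} (ht : t ∈ Icc 0 l) :
    ‖hermite l x₀ x₁ y₀ y₁ t‖ ≤ (1 + l) * (‖x₀‖ + ‖x₁‖ + ‖y₀‖ + ‖y₁‖) := by
  have hl : 0 ≤ l := ht.1.trans ht.2
  have hs₀ : 0 ≤ t / l := div_nonneg ht.1 hl
  have hs₁ : t / l ≤ 1 := div_le_one_of_le₀ ht.2 hl
  have hvalue : ∀ r : ℝ, |r| ≤ 1 → |r| ≤ 1 + l := fun r hr => by linarith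
  have hslope : ∀ r : ℝ, |r| ≤ 1 → |l * r| ≤ 1 + l := fun r hr => by
    rw [abs_mul, abs_of_nonneg hl]
    nlinarith
  rw [hermite]
  generalize t / l = s at hs₀ hs₁
  refine norm_add_four_smul_le (hvalue _ ?_) (hvalue _ ?_) (hslope _ ?_) (hslope _ ?_) _ _ _ _ <;>
    rw [abs_le] <;> constructor <;>
    nlinarith [mul_nonneg hs₀ (sub_nonneg.2 hs₁), pow_nonneg hs₀ 2, pow_nonneg hs₀ 3,
      mul_nonneg (pow_nonneg hs₀ 2) (sub_nonneg.2 hs₁),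
      mul_nonneg hs₀ (pow_nonneg (sub_nonneg.2 hs₁) 2)]

theorem norm_hermiteD2_le (x₀ x₁ y₀ y₁ : E) (hl : 0 < l) {t : ℝ} (ht : t ∈ Icc 0 l) :
    ‖hermiteD2 l x₀ x₁ y₀ y₁ t‖ ≤ (6 + 6 * l) / l ^ 2 * (‖x₀‖ + ‖x₁‖ + ‖y₀‖ + ‖y₁‖) := by
  have hs₀ : 0 ≤ t / l := div_nonneg ht.1 hl.le
  have hs₁ : t / l ≤ 1 := div_le_one_of_le₀ ht.2 hl.le
  have hvalue : ∀ r : ℝ, |r| ≤ 6 → |r / l ^ 2| ≤ (6 + 6 * l) / l ^ 2 := fun r hr => by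
    rw [abs_div, abs_of_pos (pow_pos hl 2)]
    gcongr
    linarith
  have hslope : ∀ r : ℝ, |r| ≤ 6 → |r / l| ≤ (6 + 6 * l) / l ^ 2 := fun r hr => by
    rw [abs_div, abs_of_pos hl, div_le_div_iff₀ hl (pow_pos hl 2)]
    nlinarith [mul_le_mul_of_nonneg_right hr (sq_nonneg l)]
  rw [hermiteD2]
  refine norm_add_four_smul_le (hvalue _ ?_) (hvalue _ ?_) (hslope _ ?_) (hslope _ ?_) _ _ _ _ <;>
    rw [abs_le] <;> constructor <;> linarith

end Hermite

/-! ### Weak solutions of `-y'' + V y = k` on a segment -/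

section Weak

open scoped InnerProductSpace

theorem memLp_of_continuousOn_Icc {E : Type*} [NormedAddCommGroup E] {l : ℝ} {p : ℝ≥0∞}
    {f : ℝ → E} (hf : ContinuousOn f (Icc 0 l)) : MemLp f p (segMeasure l) := by
  obtain ⟨C, hC⟩ := isCompact_Icc.exists_bound_of_continuousOn hf
  refine MemLp.of_bound (hf.aestronglyMeasurable measurableSet_Icc) C ?_
  filter_upwards [ae_restrict_mem measurableSet_Icc] with t ht using hC t ht

theorem memLp_smul_of_continuousOn_Icc {E : Type*} [NormedAddCommGroup E] [NormedSpace ℝ E]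
    {l : ℝ} {p : ℝ≥0∞} {V : ℝ → ℝ} {f : ℝ → E} (hV : MemLp V p (segMeasure l))
    (hf : ContinuousOn f (Icc 0 l)) : MemLp (fun t => V t • f t) p (segMeasure l) :=
  (memLp_of_continuousOn_Icc (p := ∞) hf).smul hV

/-- `f` belongs to the Sobolev space `H²([0,l],E)`, with derivatives `f'` and `f''`. -/
structure IsH2On {E : Type*} [NormedAddCommGroup E] [NormedSpace ℝ E] (l : ℝ)
    (f f' f'' : ℝ → E) : Prop where
  primitive : IsPrimitive l f f'
  primitive_deriv : IsPrimitive l f' f''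
  memLp : MemLp f'' 2 (segMeasure l)

/-- `f` belongs to `H²₀([0,l],E)`: it is in `H²` and vanishes with its first derivative at both
end points. -/
structure IsH2ZeroOn {E : Type*} [NormedAddCommGroup E] [NormedSpace ℝ E] (l : ℝ)
    (f f' f'' : ℝ → E) : Prop extends IsH2On l f f' f'' where
  left : f 0 = 0
  right : f l = 0
  deriv_left : f' 0 = 0
  deriv_right : f' l = 0

section NormedSpace

variable {E : Type*} [NormedAddCommGroup E] [NormedSpace ℝ E] {l : ℝ}
  {f f' f'' g g' g'' : ℝ → E}

theorem IsH2On.add (hf : IsH2On l f f' f'') (hg : IsH2On l g g' g'') :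
    IsH2On l (fun t => f t + g t) (fun t => f' t + g' t) (fun t => f'' t + g'' t) where
  primitive := hf.primitive.add hg.primitive
  primitive_deriv := hf.primitive_deriv.add hg.primitive_deriv
  memLp := hf.memLp.add hg.memLp

variable [CompleteSpace E]

theorem isH2On_of_hasDerivAt (hf : ∀ t, HasDerivAt f (f' t) t) (hf' : ∀ t, HasDerivAt f' (f'' t) t)
    (hf'' : Continuous f'') (l : ℝ) : IsH2On l f f' f'' where
  primitive := .of_hasDerivAt hf (continuous_iff_continuousAt.2 fun t => (hf' t).continuousAt) l
  primitive_deriv := .of_hasDerivAt hf' hf'' l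
  memLp := memLp_of_continuousOn_Icc hf''.continuousOn

theorem isH2On_hermite (hl : l ≠ 0) (x₀ x₁ y₀ y₁ : E) :
    IsH2On l (hermite l x₀ x₁ y₀ y₁) (hermiteD1 l x₀ x₁ y₀ y₁) (hermiteD2 l x₀ x₁ y₀ y₁) :=
  isH2On_of_hasDerivAt (hasDerivAt_hermite hl _ _ _ _) (hasDerivAt_hermiteD1 hl _ _ _ _)
    (continuous_hermiteD2 _ _ _ _) l

theorem isH2On_affine (x v : E) (l : ℝ) :
    IsH2On l (fun t => x + t • v) (fun _ => v) (fun _ => 0) :=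
  isH2On_of_hasDerivAt
    (fun t => by simpa only [id_eq, one_smul] using ((hasDerivAt_id t).smul_const v).const_add x)
    (fun t => hasDerivAt_const t v) continuous_const l

theorem isH2On_integral_integral (hf : MemLp f 2 (segMeasure l)) :
    IsH2On l (fun t => ∫ s in (0 : ℝ)..t, ∫ r in (0 : ℝ)..s, f r)
      (fun t => ∫ s in (0 : ℝ)..t, f s) f where
  primitive := .integral (IsPrimitive.integral
    (hf.integrable one_le_two)).continuousOn.integrableOn_Icc
  primitive_deriv := .integral (hf.integrable one_le_two)
  memLp := hf

end NormedSpace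

variable {𝕜 E : Type*} [RCLike 𝕜] [NormedAddCommGroup E] [InnerProductSpace 𝕜 E]

section

variable {α : Type*} {m : MeasurableSpace α} {μ : Measure α} {f g h : α → E}

theorem integrable_inner_of_memLp (hf : MemLp f 2 μ) (hg : MemLp g 2 μ) :
    Integrable (fun t => ⟪f t, g t⟫_𝕜) μ := by
  refine (L2.integrable_inner (𝕜 := 𝕜) hf.toLp hg.toLp).congr ?_
  filter_upwards [hf.coeFn_toLp, hg.coeFn_toLp] with t hft hgt
  rw [hft, hgt]

theorem integral_inner_add_right (hf : MemLp f 2 μ) (hg : MemLp g 2 μ) (hh : MemLp h 2 μ) :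
    ∫ t, ⟪f t, g t + h t⟫_𝕜 ∂μ = ∫ t, ⟪f t, g t⟫_𝕜 ∂μ + ∫ t, ⟪f t, h t⟫_𝕜 ∂μ := by
  simp only [inner_add_right]
  exact integral_add (integrable_inner_of_memLp hf hg) (integrable_inner_of_memLp hf hh)

variable (𝕜) in
theorem ae_eq_zero_of_integral_inner_self_eq_zero (hf : MemLp f 2 μ)
    (h : ∫ t, ⟪f t, f t⟫_𝕜 ∂μ = 0) : f =ᵐ[μ] 0 := by
  have hinner : ⟪hf.toLp, hf.toLp⟫_𝕜 = 0 := by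
    rw [L2.inner_def, ← h]
    refine integral_congr_ae ?_
    filter_upwards [hf.coeFn_toLp] with t ht
    rw [ht]
  exact (MemLp.toLp_eq_toLp_iff hf MemLp.zero).1
    ((inner_self_eq_zero.1 hinner).trans (MemLp.toLp_zero _).symm)

end

variable [NormedSpace ℝ E] [IsScalarTower ℝ 𝕜 E]

variable (𝕜 E) in
/-- The inner product as a real bilinear map, for use in the product rule. -/
def innerBilin : E →L[ℝ] E →L[ℝ] 𝕜 :=
  (isBoundedBilinearMap_inner (𝕜 := 𝕜) (E := E)).toContinuousLinearMap

variable [CompleteSpace E] {l : ℝ} {u u' u'' v v' v'' : ℝ → E}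

variable (𝕜) in
theorem integral_inner_add_integral_inner (hl : 0 ≤ l) (hu : IsPrimitive l u u')
    (hv : IsPrimitive l v v') :
    ∫ t, ⟪u' t, v t⟫_𝕜 ∂segMeasure l + ∫ t, ⟪u t, v' t⟫_𝕜 ∂segMeasure l
      = ⟪u l, v l⟫_𝕜 - ⟪u 0, v 0⟫_𝕜 := by
  have huv := integrableOn_bilin_continuousOn (innerBilin 𝕜 E) hu.integrableOn hv.continuousOn
  have hvu := integrableOn_bilin_continuousOn (innerBilin 𝕜 E).flip hv.integrableOn hu.continuousOn
  exact (integral_add huv hvu).symm.trans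
    ((hu.bilin (innerBilin 𝕜 E) hl hv).setIntegral_eq_sub hl)

variable (𝕜) in
theorem IsH2ZeroOn.integral_inner_deriv_deriv (hl : 0 ≤ l) (hu : IsH2ZeroOn l u u' u'')
    (hv : IsPrimitive l v v') (hv' : IsPrimitive l v' v'') :
    ∫ t, ⟪u'' t, v t⟫_𝕜 ∂segMeasure l = ∫ t, ⟪u t, v'' t⟫_𝕜 ∂segMeasure l := by
  have hderiv := integral_inner_add_integral_inner 𝕜 hl hu.primitive_deriv hv
  have hvalue := integral_inner_add_integral_inner 𝕜 hl hu.primitive hv'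
  rw [hu.deriv_left, hu.deriv_right] at hderiv
  rw [hu.left, hu.right] at hvalue
  simp only [inner_zero_left, sub_zero] at hderiv hvalue
  linear_combination hderiv - hvalue

theorem exists_ae_eq_affine_of_integral_inner_deriv_deriv_eq_zero (hl : 0 < l) {q : ℝ → E}
    (hq : MemLp q 2 (segMeasure l))
    (h : ∀ u u' u'' : ℝ → E, IsH2ZeroOn l u u' u'' → ∫ t, ⟪u'' t, q t⟫_𝕜 ∂segMeasure l = 0) :
    ∃ x v : E, q =ᵐ[segMeasure l] fun t => x + t • v := by
  have hQ := isH2On_integral_integral hq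
  set Q' : ℝ → E := fun t => ∫ s in (0 : ℝ)..t, q s
  set Q : ℝ → E := fun t => ∫ s in (0 : ℝ)..t, Q' s
  set p : ℝ → E := hermiteD2 l 0 (-Q l) 0 (-Q' l)
  have hp : MemLp p 2 (segMeasure l) := (isH2On_hermite hl.ne' _ _ _ _).memLp
  obtain ⟨x, v, hpaffine⟩ : ∃ x v : E, ∀ t, p t = x + t • v := hermiteD2_eq_affine _ _ _ _
  -- subtracting from `Q` its Hermite interpolant leaves a test function, with second derivative
  -- `q + p`; hence `q + p` is orthogonal both to `q` and to the affine function `p`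
  have htest : IsH2ZeroOn l (fun t => Q t + hermite l 0 (-Q l) 0 (-Q' l) t)
      (fun t => Q' t + hermiteD1 l 0 (-Q l) 0 (-Q' l) t) (fun t => q t + p t) :=
    { toIsH2On := hQ.add (isH2On_hermite hl.ne' _ _ _ _)
      left := by simp only [Q, hermite_zero, intervalIntegral.integral_same, add_zero]
      right := by rw [hermite_right hl.ne', add_neg_cancel]
      deriv_left := by simp only [Q', hermiteD1_zero, intervalIntegral.integral_same, add_zero]
      deriv_right := by rw [hermiteD1_right hl.ne', add_neg_cancel] }
  have horth : ∫ t, ⟪q t + p t, p t⟫_𝕜 ∂segMeasure l = 0 := by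
    have haffine := isH2On_affine x v l
    simpa only [hpaffine, inner_zero_right, integral_zero] using
      htest.integral_inner_deriv_deriv 𝕜 hl.le haffine.primitive haffine.primitive_deriv
  have hself : ∫ t, ⟪q t + p t, q t + p t⟫_𝕜 ∂segMeasure l = 0 := by
    rw [integral_inner_add_right htest.memLp hq hp, horth, h _ _ _ htest, add_zero]
  refine ⟨-x, -v, ?_⟩
  filter_upwards [ae_eq_zero_of_integral_inner_self_eq_zero 𝕜 htest.memLp hself] with t ht
  rw [Pi.zero_apply, hpaffine] at ht
  rw [eq_neg_of_add_eq_zero_left ht, neg_add, smul_neg]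

theorem exists_isH2On_of_weak_solution (hl : 0 < l) {V : ℝ → ℝ} (hV : MemLp V 2 (segMeasure l))
    {y k : ℝ → E} (hy : MemLp y 2 (segMeasure l)) (hk : MemLp k 2 (segMeasure l))
    (h : ∀ u u' u'' : ℝ → E, IsH2ZeroOn l u u' u'' →
      ∫ t, ⟪u t, k t⟫_𝕜 ∂segMeasure l = ∫ t, ⟪-u'' t + V t • u t, y t⟫_𝕜 ∂segMeasure l) :
    ∃ z z' z'' : ℝ → E, IsH2On l z z' z'' ∧ y =ᵐ[segMeasure l] z ∧
      k =ᵐ[segMeasure l] fun t => -z'' t + V t • z t := by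
  set G : ℝ → E := fun t => V t • y t - k t with hG
  have hVy : Integrable (fun t => V t • y t) (segMeasure l) :=
    memLp_one_iff_integrable.1 (hy.smul hV)
  have hF' : IsPrimitive l _ G := .integral (hVy.sub (hk.integrable one_le_two))
  have hF := IsPrimitive.integral (hF'.continuousOn.integrableOn_Icc)
  set F : ℝ → E := fun t => ∫ s in (0 : ℝ)..t, ∫ r in (0 : ℝ)..s, G r
  have hFmem : MemLp F 2 (segMeasure l) := memLp_of_continuousOn_Icc hF.continuousOn
  obtain ⟨x, v, hxv⟩ := exists_ae_eq_affine_of_integral_inner_deriv_deriv_eq_zero (𝕜 := 𝕜) hl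
    (hy.sub hFmem) fun u u' u'' hu => by
    have hVuy := integrable_inner_of_memLp (𝕜 := 𝕜)
      (memLp_smul_of_continuousOn_Icc hV hu.primitive.continuousOn) hy
    have huk := integrable_inner_of_memLp (𝕜 := 𝕜)
      (memLp_of_continuousOn_Icc hu.primitive.continuousOn) hk
    have huy := integrable_inner_of_memLp (𝕜 := 𝕜) hu.memLp hy
    have huF := integrable_inner_of_memLp (𝕜 := 𝕜) hu.memLp hFmem
    have hweak := h u u' u'' hu
    have hgreen := hu.integral_inner_deriv_deriv 𝕜 hl.le hF hF'
    simp only [hG, inner_sub_right, inner_smul_right_eq_smul, neg_add_eq_sub,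
      inner_sub_left, inner_smul_left_eq_smul, Pi.sub_apply] at hVuy hweak hgreen ⊢
    rw [integral_sub huy huF, hgreen, integral_sub hVuy huk, hweak,
      integral_sub hVuy huy, sub_sub_cancel, sub_self]
  have hyz : y =ᵐ[segMeasure l] fun t => F t + (x + t • v) := by
    filter_upwards [hxv] with t ht
    rw [← ht, Pi.sub_apply, add_sub_cancel]
  have hz := hF.add (isH2On_affine x v l).primitive
  have hz' := hF'.add (isH2On_affine x v l).primitive_deriv
  simp only [add_zero] at hz'
  refine ⟨_, _, G, ⟨hz, hz', ?_⟩, hyz, ?_⟩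
  · refine ((memLp_smul_of_continuousOn_Icc hV hz.continuousOn).sub hk).ae_eq ?_
    filter_upwards [hyz] with t ht
    simp only [hG, Pi.sub_apply, ht]
  · filter_upwards [hyz] with t ht
    rw [hG, ← ht, neg_sub, sub_add_cancel]

end Weak

/-! ### The gauge transformation of an edge -/

namespace RashbaNetwork

open ContinuousLinearMap (adjoint)

section Potential

variable (N : RashbaNetwork) (e : N.edge)

theorem contDiff_a : ContDiff ℝ 1 (N.a e) :=
  (N.A_contDiff.comp (contDiff_const.add (contDiff_id.smul contDiff_const))).inner ℝ contDiff_const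

theorem continuous_a : Continuous (N.a e) := (N.contDiff_a e).continuous

theorem hasDerivAt_a (t : ℝ) : HasDerivAt (N.a e) (deriv (N.a e) t) t :=
  ((N.contDiff_a e).differentiable one_ne_zero t).hasDerivAt

/-- The Rashba term `k_R σ` on an edge. -/
def rashba : Spin →L[ℂ] Spin := (N.kR : ℂ) • (N.spinMat e).toContinuousLinearMap

/-- The matrix potential `a + k_R σ` on an edge. -/
def pot (t : ℝ) : Spin →L[ℂ] Spin := (N.a e t : ℂ) • 1 + N.rashba e

theorem pot_apply (t : ℝ) (x : Spin) :
    N.pot e t x = (N.a e t : ℂ) • x + (N.kR : ℂ) • N.spinMat e x := rfl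

theorem isSelfAdjoint_rashba : IsSelfAdjoint (N.rashba e) := by
  have hsymm : (N.spinMat e).IsSymmetric := by
    refine Matrix.isSymmetric_toEuclideanLin_iff.2 ?_
    ext i j
    fin_cases i <;> fin_cases j <;> simp [Matrix.conjTranspose_apply, sub_eq_add_neg]
  exact IsSelfAdjoint.smul (Complex.conj_ofReal _)
    (ContinuousLinearMap.isSelfAdjoint_iff_isSymmetric.2 hsymm)

theorem inner_pot_left (t : ℝ) (x y : Spin) :
    inner ℂ (N.pot e t x) y = inner ℂ x (N.pot e t y) := by
  have hrashba : inner ℂ (N.rashba e x) y = inner ℂ x (N.rashba e y) :=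
    (N.isSelfAdjoint_rashba e).isSymmetric x y
  simp only [pot, add_apply, smul_apply, one_apply_eq_self, inner_add_left, inner_add_right,
    inner_smul_left, inner_smul_right, Complex.conj_ofReal, hrashba]

theorem hasDerivAt_pot (t : ℝ) :
    HasDerivAt (N.pot e) (((deriv (N.a e) t : ℝ) : ℂ) • (1 : Spin →L[ℂ] Spin)) t :=
  ((N.hasDerivAt_a e t).ofReal_comp.smul_const _).add_const _

theorem continuous_pot : Continuous (N.pot e) :=
  continuous_iff_continuousAt.2 fun t => (N.hasDerivAt_pot e t).continuousAt

end Potential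

section Gauge

variable (N : RashbaNetwork) (e : N.edge)

/-- The unitary gauge transformation that removes the matrix potential of an edge. The scalar and
the Rashba part of the potential commute, so it is a product of two exponentials. -/
def gauge (t : ℝ) : Spin →L[ℂ] Spin :=
  Complex.exp (((∫ s in (0 : ℝ)..t, N.a e s : ℝ) : ℂ) * Complex.I) •
    NormedSpace.exp ((t : ℂ) • (Complex.I • N.rashba e))

theorem hasDerivAt_gauge (t : ℝ) :
    HasDerivAt (N.gauge e) (Complex.I • (N.pot e t * N.gauge e t)) t := by
  have hphase : HasDerivAt (fun t : ℝ => ∫ s in (0 : ℝ)..t, N.a e s) (N.a e t) t :=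
    intervalIntegral.integral_hasDerivAt_right ((N.continuous_a e).intervalIntegrable _ _)
      ((N.continuous_a e).stronglyMeasurableAtFilter _ _) (N.continuous_a e).continuousAt
  have hexp := (hasDerivAt_exp_smul_const' (Complex.I • N.rashba e) (t : ℂ)).scomp t
    Complex.ofRealCLM.hasDerivAt
  refine ((hphase.ofReal_comp.mul_const Complex.I).cexp.smul hexp).congr_deriv ?_
  simp only [gauge, pot, add_mul, smul_mul_assoc, mul_smul_comm, one_mul, smul_add, smul_smul]
  rw [add_comm]
  congr 2
  · ring
  · simp [mul_comm]

theorem continuous_gauge : Continuous (N.gauge e) :=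
  continuous_iff_continuousAt.2 fun t => (N.hasDerivAt_gauge e t).continuousAt

theorem gauge_mem_unitary (t : ℝ) : N.gauge e t ∈ unitary (Spin →L[ℂ] Spin) := by
  have hphase : Complex.exp (((∫ s in (0 : ℝ)..t, N.a e s : ℝ) : ℂ) * Complex.I) ∈ unitary ℂ := by
    rw [Unitary.mem_iff_star_mul_self, Complex.star_def, Complex.conj_mul',
      Complex.norm_exp_ofReal_mul_I, Complex.ofReal_one, one_pow]
  have hskew : (t : ℂ) • (Complex.I • N.rashba e) ∈ skewAdjoint (Spin →L[ℂ] Spin) := by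
    rw [smul_smul]
    refine (N.isSelfAdjoint_rashba e).smul_mem_skewAdjoint ?_
    simp [skewAdjoint.mem_iff]
  let : NormedAlgebra ℚ (Spin →L[ℂ] Spin) := .restrictScalars ℚ ℂ _
  exact Unitary.smul_mem_of_mem hphase (NormedSpace.exp_mem_unitary_of_mem_skewAdjoint hskew)

theorem norm_gauge (t : ℝ) (x : Spin) : ‖N.gauge e t x‖ = ‖x‖ :=
  ContinuousLinearMap.norm_map_of_mem_unitary (N.gauge_mem_unitary e t) x

/-- The inverse of the gauge transformation. -/
def gaugeInv (t : ℝ) : Spin →L[ℂ] Spin := adjoint (N.gauge e t)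

theorem gauge_gaugeInv (t : ℝ) (x : Spin) : N.gauge e t (N.gaugeInv e t x) = x :=
  DFunLike.congr_fun (Unitary.mul_star_self_of_mem (N.gauge_mem_unitary e t)) x

theorem norm_gaugeInv (t : ℝ) (x : Spin) : ‖N.gaugeInv e t x‖ = ‖x‖ := by
  rw [← N.norm_gauge e t, gauge_gaugeInv]

theorem continuous_gaugeInv : Continuous (N.gaugeInv e) :=
  (adjoint (𝕜 := ℂ) (E := Spin) (F := Spin)).continuous.comp (N.continuous_gauge e)

theorem inner_gauge_left (t : ℝ) (x y : Spin) :
    inner ℂ (N.gauge e t x) y = inner ℂ x (N.gaugeInv e t y) :=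
  (ContinuousLinearMap.adjoint_inner_right _ _ _).symm

end Gauge

section Primitive

variable {N : RashbaNetwork} {l : ℝ} {f f' : ℝ → Spin}

theorem isPrimitive_pot (hl : 0 ≤ l) (e : N.edge) (hf : IsPrimitive l f f') :
    IsPrimitive l (fun t => N.pot e t (f t))
      (fun t => ((deriv (N.a e) t : ℝ) : ℂ) • f t + N.pot e t (f' t)) := by
  have hpot : IsPrimitive l (N.pot e) fun t => ((deriv (N.a e) t : ℝ) : ℂ) • 1 :=
    .of_hasDerivAt (N.hasDerivAt_pot e) ((Complex.continuous_ofReal.comp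
      ((N.contDiff_a e).continuous_deriv le_rfl)).smul continuous_const) l
  exact hpot.bilin (ContinuousLinearMap.restrictScalarsL ℂ Spin Spin ℝ ℝ) hl hf

theorem isPrimitive_gauge (hl : 0 ≤ l) (e : N.edge) (hf : IsPrimitive l f f') :
    IsPrimitive l (fun t => N.gauge e t (f t))
      (fun t => Complex.I • N.pot e t (N.gauge e t (f t)) + N.gauge e t (f' t)) := by
  have hgauge : IsPrimitive l (N.gauge e) fun t => Complex.I • (N.pot e t * N.gauge e t) :=
    .of_hasDerivAt (N.hasDerivAt_gauge e)
      (((N.continuous_pot e).mul (N.continuous_gauge e)).const_smul Complex.I) l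
  exact hgauge.bilin (ContinuousLinearMap.restrictScalarsL ℂ Spin Spin ℝ ℝ) hl hf

end Primitive

end RashbaNetwork

/-! ### The operator on a single edge -/

theorem IsH2Rep.isH2On {l : ℝ} {u : SegL2 l} {f f' f'' : ℝ → Spin} (h : IsH2Rep l u f f' f'') :
    IsH2On l f f' f'' := ⟨⟨h.int1, h.eq⟩, ⟨h.int2, h.deriv_eq⟩, h.memLp⟩

theorem IsH2On.isH2Rep {l : ℝ} {u : SegL2 l} {f f' f'' : ℝ → Spin} (h : IsH2On l f f' f'')
    (hu : u =ᵐ[segMeasure l] f) : IsH2Rep l u f f' f'' :=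
  ⟨hu, h.memLp, h.primitive_deriv.eq, h.primitive.eq⟩

namespace RashbaNetwork

section Edge

variable {N : RashbaNetwork} (e : N.edge) {f f' f'' g g' g'' : ℝ → Spin} {t : ℝ}

/-- `f` belongs to `H²` on the edge `e`, and the differential expression `L_e` maps it to `h`. -/
structure IsEdgePair (f h : SegL2 (N.len e)) : Prop where
  isH2 : IsH2 _ f
  image : h =ᵐ[segMeasure (N.len e)] N.edgeExpr e (h2Val _ f) (h2D1 _ f) (h2D2 _ f)

/-- The covariant derivative `∇_e f` of an element of `H²` on the edge `e`. -/
def cov (f : SegL2 (N.len e)) : ℝ → Spin := N.covDeriv e (h2Val _ f) (h2D1 _ f)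

/-- The boundary form of `f` and `g` at the point `t` of the edge `e`. -/
def boundaryForm (f g : SegL2 (N.len e)) (t : ℝ) : ℂ :=
  inner ℂ (h2Val _ f t) (cov e g t) - inner ℂ (cov e f t) (h2Val _ g t)

/-- The effective scalar potential `U - k_R²`, the only potential that remains in `L_e` after the
gauge transformation. -/
def effPot (t : ℝ) : ℝ := N.U e t - N.kR ^ 2

theorem memLp_effPot : MemLp (N.effPot e) 2 (segMeasure (N.len e)) :=
  (N.U_memLp e).sub (memLp_const _)

theorem edgeExpr_congr (h : f t = g t) (h' : f' t = g' t) (h'' : f'' t = g'' t) :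
    N.edgeExpr e f f' f'' t = N.edgeExpr e g g' g'' t := by
  simp only [edgeExpr, momentum, momentumDeriv, h, h', h'']

theorem covDeriv_congr (h : f t = g t) (h' : f' t = g' t) :
    N.covDeriv e f f' t = N.covDeriv e g g' t := by
  simp only [covDeriv, h, h']

theorem _root_.IsH2Rep.isEdgePair {e : N.edge} {u h : SegL2 (N.len e)}
    (hu : IsH2Rep _ u f f' f'') (hh : h =ᵐ[segMeasure (N.len e)] N.edgeExpr e f f' f'') :
    IsEdgePair e u h where
  isH2 := hu.isH2
  image := by
    obtain ⟨hval, hderiv, hderiv₂⟩ := hu.unique (N.len_pos e) hu.isH2.rep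
    filter_upwards [hh, hderiv₂, ae_restrict_mem measurableSet_Icc] with t ht ht₂ htmem
    rw [ht, edgeExpr_congr e (hval t htmem) (hderiv t htmem) ht₂]

theorem covDeriv_eq (f f' : ℝ → Spin) (t : ℝ) :
    N.covDeriv e f f' t = f' t - Complex.I • N.pot e t (f t) := rfl

theorem momentum_eq (f f' : ℝ → Spin) (t : ℝ) :
    N.momentum e f f' t = Complex.I • N.covDeriv e f f' t := by
  rw [covDeriv_eq, smul_sub, smul_smul, Complex.I_mul_I, neg_one_smul, sub_neg_eq_add, pot_apply,
    momentum, add_assoc]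

theorem momentumDeriv_eq (f f' f'' : ℝ → Spin) (t : ℝ) :
    N.momentumDeriv e f f' f'' t
      = Complex.I • f'' t + (((deriv (N.a e) t : ℝ) : ℂ) • f t + N.pot e t (f' t)) := by
  rw [momentumDeriv, pot_apply]
  abel

theorem edgeExpr_eq (f f' f'' : ℝ → Spin) (t : ℝ) :
    N.edgeExpr e f f' f'' t = Complex.I • N.momentumDeriv e f f' f'' t
      + Complex.I • N.pot e t (N.covDeriv e f f' t) + N.effPot e t • f t := by
  rw [edgeExpr, momentum, add_assoc (Complex.I • _), ← pot_apply, momentum_eq, map_smul, effPot,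
    ← Complex.coe_smul]
  push_cast
  rw [sub_smul]
  abel

theorem isPrimitive_covDeriv {l : ℝ} (hl : 0 ≤ l) (hf : IsH2On l f f' f'') :
    IsPrimitive l (N.covDeriv e f f') (fun t => -(Complex.I • N.momentumDeriv e f f' f'' t)) := by
  have hpot := (isPrimitive_pot hl e hf.primitive).clm_apply
    ((-Complex.I • (1 : Spin →L[ℂ] Spin)).restrictScalars ℝ)
  refine (hf.primitive_deriv.add hpot).congr (fun t _ => ?_) (.of_forall fun t => ?_)
  · rw [covDeriv_eq, sub_eq_add_neg, ← neg_smul]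
    rfl
  · dsimp only
    rw [momentumDeriv_eq, smul_add, smul_smul, Complex.I_mul_I, neg_one_smul, neg_add, neg_neg,
      ← neg_smul]
    rfl

theorem lagrange_identity (f f' f'' g g' g'' : ℝ → Spin) (t : ℝ) :
    inner ℂ (f t) (N.edgeExpr e g g' g'' t) - inner ℂ (N.edgeExpr e f f' f'' t) (g t)
      = (inner ℂ (-(Complex.I • N.momentumDeriv e f f' f'' t)) (g t)
          + inner ℂ (N.covDeriv e f f' t) (g' t))
        - (inner ℂ (f' t) (N.covDeriv e g g' t)
          + inner ℂ (f t) (-(Complex.I • N.momentumDeriv e g g' g'' t))) := by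
  have hf : inner ℂ (f' t) (N.covDeriv e g g' t)
      = inner ℂ (N.covDeriv e f f' t) (N.covDeriv e g g' t)
        - Complex.I * inner ℂ (f t) (N.pot e t (N.covDeriv e g g' t)) := by
    rw [covDeriv_eq e f, inner_sub_left, inner_smul_left, Complex.conj_I, N.inner_pot_left]
    ring
  have hg : inner ℂ (N.covDeriv e f f' t) (g' t)
      = inner ℂ (N.covDeriv e f f' t) (N.covDeriv e g g' t)
        + Complex.I * inner ℂ (N.pot e t (N.covDeriv e f f' t)) (g t) := by
    rw [covDeriv_eq e g, inner_sub_right, inner_smul_right, ← N.inner_pot_left]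
    ring
  rw [hf, hg, edgeExpr_eq, edgeExpr_eq]
  simp only [← Complex.coe_smul, inner_add_left, inner_add_right, inner_smul_left,
    inner_smul_right, inner_neg_left, inner_neg_right, Complex.conj_I, Complex.conj_ofReal]
  ring

variable {e}

theorem IsEdgePair.green {f h g k : SegL2 (N.len e)} (hf : IsEdgePair e f h)
    (hg : IsEdgePair e g k) :
    inner ℂ f k - inner ℂ h g = boundaryForm e f g 0 - boundaryForm e f g (N.len e) := by
  have hl := (N.len_pos e).le
  have hf₂ := hf.isH2.rep.isH2On
  have hg₂ := hg.isH2.rep.isH2On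
  have hvalue := hf₂.primitive.bilin (innerBilin ℂ Spin) hl (isPrimitive_covDeriv e hl hg₂)
  have hderiv := (isPrimitive_covDeriv e hl hf₂).bilin (innerBilin ℂ Spin) hl hg₂.primitive
  calc inner ℂ f k - inner ℂ h g
      = ∫ t, (inner ℂ (f t) (k t) - inner ℂ (h t) (g t)) ∂segMeasure (N.len e) := by
        rw [integral_sub (L2.integrable_inner f k) (L2.integrable_inner h g), L2.inner_def,
          L2.inner_def]
    _ = ∫ t, (inner ℂ (h2Val _ f t) (N.edgeExpr e (h2Val _ g) (h2D1 _ g) (h2D2 _ g) t)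
          - inner ℂ (N.edgeExpr e (h2Val _ f) (h2D1 _ f) (h2D2 _ f) t) (h2Val _ g t))
          ∂segMeasure (N.len e) := by
        refine integral_congr_ae ?_
        filter_upwards [hf.image, hg.image, hf.isH2.rep.ae_eq, hg.isH2.rep.ae_eq]
          with t hht hkt hft hgt
        rw [hht, hkt, hft, hgt]
    _ = (inner ℂ (cov e f (N.len e)) (h2Val _ g (N.len e)) - inner ℂ (cov e f 0) (h2Val _ g 0))
          - (inner ℂ (h2Val _ f (N.len e)) (cov e g (N.len e))
            - inner ℂ (h2Val _ f 0) (cov e g 0)) := by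
        simp only [lagrange_identity]
        exact (integral_sub hderiv.integrableOn hvalue.integrableOn).trans
          (congrArg₂ (· - ·) (hderiv.setIntegral_eq_sub hl) (hvalue.setIntegral_eq_sub hl))
    _ = boundaryForm e f g 0 - boundaryForm e f g (N.len e) := by
        rw [boundaryForm, boundaryForm]
        ring

end Edge

section GaugedEdge

variable {N : RashbaNetwork} (e : N.edge) {u u' u'' : ℝ → Spin}

/-- The first derivative of `gauge e t (u t)`. -/
def gaugeD1 (u u' : ℝ → Spin) (t : ℝ) : Spin :=
  Complex.I • N.pot e t (N.gauge e t (u t)) + N.gauge e t (u' t)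

/-- The second derivative of `gauge e t (u t)`. -/
def gaugeD2 (u u' u'' : ℝ → Spin) (t : ℝ) : Spin :=
  Complex.I • (((deriv (N.a e) t : ℝ) : ℂ) • N.gauge e t (u t) + N.pot e t (gaugeD1 e u u' t))
    + (Complex.I • N.pot e t (N.gauge e t (u' t)) + N.gauge e t (u'' t))

theorem covDeriv_gauge (u u' : ℝ → Spin) (t : ℝ) :
    N.covDeriv e (fun t => N.gauge e t (u t)) (gaugeD1 e u u') t = N.gauge e t (u' t) := by
  rw [covDeriv_eq, gaugeD1, add_sub_cancel_left]

theorem edgeExpr_gauge (u u' u'' : ℝ → Spin) (t : ℝ) :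
    N.edgeExpr e (fun t => N.gauge e t (u t)) (gaugeD1 e u u') (gaugeD2 e u u' u'') t
      = N.gauge e t (-u'' t + N.effPot e t • u t) := by
  rw [edgeExpr_eq, covDeriv_gauge, momentumDeriv_eq, gaugeD2, map_add, map_neg,
    ← Complex.coe_smul, ← Complex.coe_smul, map_smul]
  simp only [smul_add, smul_smul, ← mul_assoc, Complex.I_mul_I]
  rw [gaugeD1]
  module

theorem memLp_gauge {μ : Measure ℝ} {f : ℝ → Spin} (hf : MemLp f 2 μ) :
    MemLp (fun t => N.gauge e t (f t)) 2 μ :=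
  hf.of_le ((ContinuousLinearMap.id ℂ (Spin →L[ℂ] Spin)).aestronglyMeasurable_comp₂
    (N.continuous_gauge e).aestronglyMeasurable hf.aestronglyMeasurable)
    (.of_forall fun t => (N.norm_gauge e t _).le)

theorem memLp_gaugeInv {μ : Measure ℝ} {f : ℝ → Spin} (hf : MemLp f 2 μ) :
    MemLp (fun t => N.gaugeInv e t (f t)) 2 μ :=
  hf.of_le ((ContinuousLinearMap.id ℂ (Spin →L[ℂ] Spin)).aestronglyMeasurable_comp₂
    (N.continuous_gaugeInv e).aestronglyMeasurable hf.aestronglyMeasurable)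
    (.of_forall fun t => (N.norm_gaugeInv e t _).le)

theorem isPrimitive_gaugeD1 {l : ℝ} (hl : 0 ≤ l) (hu : IsH2On l u u' u'') :
    IsPrimitive l (gaugeD1 e u u') (gaugeD2 e u u' u'') :=
  ((isPrimitive_pot hl e (isPrimitive_gauge hl e hu.primitive)).clm_apply
    ((Complex.I • (1 : Spin →L[ℂ] Spin)).restrictScalars ℝ)).add
    (isPrimitive_gauge hl e hu.primitive_deriv)

theorem memLp_gaugeD2 {l : ℝ} (hl : 0 ≤ l) (hu : IsH2On l u u' u'') :
    MemLp (gaugeD2 e u u' u'') 2 (segMeasure l) := by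
  have hpot : ∀ g : ℝ → Spin, ContinuousOn g (Icc 0 l) →
      ContinuousOn (fun t => N.pot e t (g t)) (Icc 0 l) :=
    fun g => (N.continuous_pot e).continuousOn.clm_apply
  have hgauge := (isPrimitive_gauge hl e hu.primitive).continuousOn
  have hderiv_a : ContinuousOn (fun t => ((deriv (N.a e) t : ℝ) : ℂ)) (Icc 0 l) :=
    (Complex.continuous_ofReal.comp ((N.contDiff_a e).continuous_deriv le_rfl)).continuousOn
  have hfst := memLp_of_continuousOn_Icc (p := 2) (((hderiv_a.smul hgauge).add
    (hpot _ (isPrimitive_gaugeD1 e hl hu).continuousOn)).const_smul Complex.I)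
  have hsnd := memLp_of_continuousOn_Icc (p := 2)
    ((hpot _ (isPrimitive_gauge hl e hu.primitive_deriv).continuousOn).const_smul Complex.I)
  exact hfst.add (hsnd.add (memLp_gauge e hu.memLp))

theorem isH2On_gauge {l : ℝ} (hl : 0 ≤ l) (hu : IsH2On l u u' u'') :
    IsH2On l (fun t => N.gauge e t (u t)) (gaugeD1 e u u') (gaugeD2 e u u' u'') :=
  ⟨isPrimitive_gauge hl e hu.primitive, isPrimitive_gaugeD1 e hl hu, memLp_gaugeD2 e hl hu⟩

theorem memLp_neg_add_effPot_smul (hu : IsH2On (N.len e) u u' u'') :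
    MemLp (fun t => -u'' t + N.effPot e t • u t) 2 (segMeasure (N.len e)) :=
  hu.memLp.neg.add (memLp_smul_of_continuousOn_Icc (memLp_effPot e) hu.primitive.continuousOn)

variable {e} {f k : SegL2 (N.len e)}

theorem isEdgePair_of_ae_eq_gauge (hu : IsH2On (N.len e) u u' u'')
    (hf : f =ᵐ[segMeasure (N.len e)] fun t => N.gauge e t (u t))
    (hk : k =ᵐ[segMeasure (N.len e)] fun t => N.gauge e t (-u'' t + N.effPot e t • u t)) :
    IsEdgePair e f k :=
  ((isH2On_gauge e (N.len_pos e).le hu).isH2Rep hf).isEdgePair <|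
    hk.trans (.of_forall fun t => (edgeExpr_gauge e u u' u'' t).symm)

theorem h2Val_of_ae_eq_gauge (hu : IsH2On (N.len e) u u' u'')
    (hf : f =ᵐ[segMeasure (N.len e)] fun t => N.gauge e t (u t)) {t : ℝ}
    (ht : t ∈ Icc 0 (N.len e)) : h2Val _ f t = N.gauge e t (u t) :=
  have hrep := (isH2On_gauge e (N.len_pos e).le hu).isH2Rep hf
  (hrep.isH2.rep.unique (N.len_pos e) hrep).1 t ht

theorem cov_of_ae_eq_gauge (hu : IsH2On (N.len e) u u' u'')
    (hf : f =ᵐ[segMeasure (N.len e)] fun t => N.gauge e t (u t)) {t : ℝ}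
    (ht : t ∈ Icc 0 (N.len e)) : cov e f t = N.gauge e t (u' t) := by
  have hrep := (isH2On_gauge e (N.len_pos e).le hu).isH2Rep hf
  obtain ⟨hval, hderiv, -⟩ := hrep.isH2.rep.unique (N.len_pos e) hrep
  rw [← covDeriv_gauge]
  exact covDeriv_congr e (hval t ht) (hderiv t ht)

end GaugedEdge

end RashbaNetwork

theorem sq_add_four_le (a b c d : ℝ) :
    (a + b + c + d) ^ 2 ≤ 4 * (a ^ 2 + b ^ 2 + c ^ 2 + d ^ 2) := by
  nlinarith [sq_nonneg (a - b), sq_nonneg (a - c), sq_nonneg (a - d), sq_nonneg (b - c),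
    sq_nonneg (b - d), sq_nonneg (c - d)]

namespace RashbaNetwork

variable {N : RashbaNetwork} {e : N.edge}

/-- `f` has the values `x₀`, `x₁` and the covariant derivatives `y₀`, `y₁` at the two ends of the
edge `e`. -/
structure HasBoundaryData (e : N.edge) (f : SegL2 (N.len e)) (x₀ x₁ y₀ y₁ : Spin) : Prop where
  left : h2Val _ f 0 = x₀
  right : h2Val _ f (N.len e) = x₁
  cov_left : cov e f 0 = y₀
  cov_right : cov e f (N.len e) = y₁

theorem exists_isEdgePair_gauge {u u' u'' : ℝ → Spin} (hu : IsH2On (N.len e) u u' u'') :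
    ∃ f k : SegL2 (N.len e), IsEdgePair e f k ∧
      HasBoundaryData e f (N.gauge e 0 (u 0)) (N.gauge e (N.len e) (u (N.len e)))
        (N.gauge e 0 (u' 0)) (N.gauge e (N.len e) (u' (N.len e))) ∧
      f =ᵐ[segMeasure (N.len e)] (fun t => N.gauge e t (u t)) ∧
      k =ᵐ[segMeasure (N.len e)] fun t => N.gauge e t (-u'' t + N.effPot e t • u t) := by
  have hf := memLp_gauge e (memLp_of_continuousOn_Icc (p := 2) hu.primitive.continuousOn)
  have hk := memLp_gauge e (memLp_neg_add_effPot_smul e hu)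
  have hleft : (0 : ℝ) ∈ Icc 0 (N.len e) := left_mem_Icc.2 (N.len_pos e).le
  have hright : N.len e ∈ Icc 0 (N.len e) := right_mem_Icc.2 (N.len_pos e).le
  exact ⟨hf.toLp, hk.toLp, isEdgePair_of_ae_eq_gauge hu hf.coeFn_toLp hk.coeFn_toLp,
    ⟨h2Val_of_ae_eq_gauge hu hf.coeFn_toLp hleft, h2Val_of_ae_eq_gauge hu hf.coeFn_toLp hright,
      cov_of_ae_eq_gauge hu hf.coeFn_toLp hleft, cov_of_ae_eq_gauge hu hf.coeFn_toLp hright⟩,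
    hf.coeFn_toLp, hk.coeFn_toLp⟩

theorem inner_eq_integral_of_ae_eq_gauge {f g : SegL2 (N.len e)} {u : ℝ → Spin}
    (hf : f =ᵐ[segMeasure (N.len e)] fun t => N.gauge e t (u t)) :
    inner ℂ f g = ∫ t, inner ℂ (u t) (N.gaugeInv e t (g t)) ∂segMeasure (N.len e) := by
  rw [L2.inner_def]
  refine integral_congr_ae ?_
  filter_upwards [hf] with t ht
  rw [ht, inner_gauge_left]

theorem isEdgePair_of_weak_solution {g k : SegL2 (N.len e)}
    (hweak : ∀ f h, IsEdgePair e f h → HasBoundaryData e f 0 0 0 0 → inner ℂ f k = inner ℂ h g) :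
    IsEdgePair e g k := by
  obtain ⟨z, z', z'', hz, hgz, hkz⟩ := exists_isH2On_of_weak_solution (𝕜 := ℂ) (N.len_pos e)
    (memLp_effPot e) (memLp_gaugeInv e (Lp.memLp g)) (memLp_gaugeInv e (Lp.memLp k))
    fun u u' u'' hu => by
      obtain ⟨f, h, hfh, hdata, hf, hh⟩ := exists_isEdgePair_gauge hu.toIsH2On
      rw [hu.left, hu.right, hu.deriv_left, hu.deriv_right, map_zero, map_zero] at hdata
      rw [← inner_eq_integral_of_ae_eq_gauge hf, ← inner_eq_integral_of_ae_eq_gauge hh]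
      exact hweak f h hfh hdata
  exact isEdgePair_of_ae_eq_gauge hz
    (hgz.mono fun t ht => (N.gauge_gaugeInv e t _).symm.trans (congrArg (N.gauge e t) ht))
    (hkz.mono fun t ht => (N.gauge_gaugeInv e t _).symm.trans (congrArg (N.gauge e t) ht))

variable (N) in
theorem exists_len_bounds : ∃ c C : ℝ, 0 < c ∧ ∀ e, c ≤ N.len e ∧ N.len e ≤ C := by
  obtain ⟨c, hc, hlower⟩ := N.length_lower
  obtain ⟨C, hupper⟩ := N.length_upper
  exact ⟨c, C, hc, fun e => ⟨hlower e.1 e.2, hupper e.1 e.2⟩⟩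

variable (N) in
theorem exists_eLpNorm_one_add_abs_effPot_le : ∃ W : NNReal, ∀ e,
    eLpNorm (fun t => 1 + |N.effPot e t|) 2 (segMeasure (N.len e)) ≤ W := by
  obtain ⟨_, C, -, hlen⟩ := N.exists_len_bounds
  obtain ⟨M, hM⟩ := N.U_bound
  refine ⟨C.toNNReal ^ (2 : ℝ)⁻¹ * (1 + N.kR ^ 2).toNNReal + M, fun e => ?_⟩
  have hconst : eLpNorm (fun _ => 1 + N.kR ^ 2) 2 (segMeasure (N.len e))
      ≤ (C.toNNReal ^ (2 : ℝ)⁻¹ * (1 + N.kR ^ 2).toNNReal : NNReal) := by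
    refine (eLpNorm_le_of_ae_bound (C := 1 + N.kR ^ 2) (.of_forall fun _ =>
      (Real.norm_of_nonneg (by positivity)).le)).trans ?_
    rw [Measure.restrict_apply_univ, Real.volume_Icc, sub_zero, ENNReal.coe_mul,
      ENNReal.coe_rpow_of_nonneg _ (by positivity), ENNReal.toReal_ofNat]
    gcongr
    · exact ENNReal.ofReal_le_ofReal (hlen e).2
    · exact le_rfl
  calc eLpNorm (fun t => 1 + |N.effPot e t|) 2 (segMeasure (N.len e))
      ≤ eLpNorm ((fun _ => 1 + N.kR ^ 2) + fun t => ‖N.U e t‖) 2 (segMeasure (N.len e)) := by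
        refine eLpNorm_mono_real fun t => ?_
        rw [Real.norm_of_nonneg (by positivity), Pi.add_apply, Real.norm_eq_abs, add_assoc]
        have := abs_sub (N.U e t) (N.kR ^ 2)
        rw [abs_of_nonneg (sq_nonneg N.kR), add_comm] at this
        exact add_le_add_right this 1
    _ ≤ eLpNorm (fun _ => 1 + N.kR ^ 2) 2 (segMeasure (N.len e))
          + eLpNorm (fun t => ‖N.U e t‖) 2 (segMeasure (N.len e)) :=
        eLpNorm_add_le aestronglyMeasurable_const (N.U_memLp e).aestronglyMeasurable.norm
          one_le_two
    _ ≤ _ := by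
        rw [eLpNorm_norm, ENNReal.coe_add]
        exact add_le_add hconst (hM e)

theorem norm_le_of_ae_eq_gauge {f : SegL2 (N.len e)} {u : ℝ → Spin} {B : ℝ} {W : NNReal}
    (hf : f =ᵐ[segMeasure (N.len e)] fun t => N.gauge e t (u t)) (hB : 0 ≤ B)
    (hu : ∀ t ∈ Icc 0 (N.len e), ‖u t‖ ≤ B * (1 + |N.effPot e t|))
    (hW : eLpNorm (fun t => 1 + |N.effPot e t|) 2 (segMeasure (N.len e)) ≤ W) :
    ‖f‖ ≤ B * W := by
  rw [Lp.norm_def]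
  refine ENNReal.toReal_le_of_le_ofReal (by positivity) ?_
  calc eLpNorm f 2 (segMeasure (N.len e))
      ≤ ENNReal.ofReal B * eLpNorm (fun t => 1 + |N.effPot e t|) 2 (segMeasure (N.len e)) := by
        refine eLpNorm_le_mul_eLpNorm_of_ae_le_mul ?_ 2
        filter_upwards [hf, ae_restrict_mem measurableSet_Icc] with t hft ht
        rw [hft, norm_gauge, Real.norm_of_nonneg (by positivity)]
        exact hu t ht
    _ ≤ ENNReal.ofReal B * W := by gcongr
    _ = ENNReal.ofReal (B * W) := by rw [ENNReal.ofReal_mul hB, ENNReal.ofReal_coe_nnreal]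

variable (N) in
theorem exists_norm_hermite_le : ∃ B : ℝ, 0 ≤ B ∧ ∀ (e : N.edge) (x₀ x₁ y₀ y₁ : Spin),
    ∀ t ∈ Icc 0 (N.len e),
      ‖hermite (N.len e) x₀ x₁ y₀ y₁ t‖ ≤ B * (‖x₀‖ + ‖x₁‖ + ‖y₀‖ + ‖y₁‖) ∧
      ‖hermiteD2 (N.len e) x₀ x₁ y₀ y₁ t‖ ≤ B * (‖x₀‖ + ‖x₁‖ + ‖y₀‖ + ‖y₁‖) := by
  obtain ⟨c, C, hc, hlen⟩ := N.exists_len_bounds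
  refine ⟨max (1 + |C|) ((6 + 6 * |C|) / c ^ 2), le_max_of_le_left (by positivity),
    fun e x₀ x₁ y₀ y₁ t ht => ⟨?_, ?_⟩⟩
  · refine (norm_hermite_le x₀ x₁ y₀ y₁ ht).trans ?_
    gcongr
    refine le_max_of_le_left ?_
    gcongr
    exact (hlen e).2.trans (le_abs_self C)
  · refine (norm_hermiteD2_le x₀ x₁ y₀ y₁ (N.len_pos e) ht).trans ?_
    gcongr
    refine le_max_of_le_right ?_
    gcongr
    · exact (hlen e).2.trans (le_abs_self C)
    · exact (hlen e).1

variable (N) in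
theorem exists_extension : ∃ K : ℝ, 0 ≤ K ∧ ∀ (e : N.edge) (x₀ x₁ y₀ y₁ : Spin),
    ∃ f k : SegL2 (N.len e), IsEdgePair e f k ∧ HasBoundaryData e f x₀ x₁ y₀ y₁ ∧
      ‖f‖ ≤ K * (‖x₀‖ + ‖x₁‖ + ‖y₀‖ + ‖y₁‖) ∧ ‖k‖ ≤ K * (‖x₀‖ + ‖x₁‖ + ‖y₀‖ + ‖y₁‖) := by
  obtain ⟨B, hB, hhermite⟩ := N.exists_norm_hermite_le
  obtain ⟨W, hW⟩ := N.exists_eLpNorm_one_add_abs_effPot_le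
  refine ⟨B * W, by positivity, fun e x₀ x₁ y₀ y₁ => ?_⟩
  have hl := (N.len_pos e).ne'
  have hbound := hhermite e (N.gaugeInv e 0 x₀) (N.gaugeInv e (N.len e) x₁)
    (N.gaugeInv e 0 y₀) (N.gaugeInv e (N.len e) y₁)
  simp only [norm_gaugeInv] at hbound
  obtain ⟨f, k, hfk, hdata, hf, hk⟩ := exists_isEdgePair_gauge
    (isH2On_hermite hl (N.gaugeInv e 0 x₀) (N.gaugeInv e (N.len e) x₁)
      (N.gaugeInv e 0 y₀) (N.gaugeInv e (N.len e) y₁))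
  rw [hermite_zero, hermite_right hl, hermiteD1_zero, hermiteD1_right hl] at hdata
  simp only [gauge_gaugeInv] at hdata
  refine ⟨f, k, hfk, hdata, ?_, ?_⟩
  · rw [mul_right_comm]
    refine norm_le_of_ae_eq_gauge hf (by positivity) (fun t ht => ?_) (hW e)
    exact (hbound t ht).1.trans (le_mul_of_one_le_right (by positivity) (by simp))
  · rw [mul_right_comm]
    refine norm_le_of_ae_eq_gauge hk (by positivity) (fun t ht => ?_) (hW e)
    refine (norm_add_le _ _).trans ?_
    rw [norm_neg, norm_smul, Real.norm_eq_abs, mul_one_add, mul_comm |_|]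
    exact add_le_add (hbound t ht).2 (mul_le_mul_of_nonneg_right (hbound t ht).1 (abs_nonneg _))

/-- The size of the boundary data of a function on an edge: the sum of the norms of its values and
its covariant derivatives at the two ends. -/
def edgeBoundaryNorm (e : N.edge) (f : SegL2 (N.len e)) : ℝ :=
  ‖h2Val _ f 0‖ + ‖h2Val _ f (N.len e)‖ + ‖cov e f 0‖ + ‖cov e f (N.len e)‖

variable (N) in
theorem exists_edgeBoundaryNorm_le : ∃ K : ℝ, ∀ (e : N.edge) (g k : SegL2 (N.len e)),
    IsEdgePair e g k → edgeBoundaryNorm e g ≤ K * (‖g‖ + ‖k‖) := by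
  obtain ⟨K, hK, hext⟩ := N.exists_extension
  refine ⟨4 * K, fun e g k hg => ?_⟩
  -- For this choice of boundary data, the boundary form in Green's identity is the sum of the
  -- squared norms of the boundary data of `g`.
  obtain ⟨f, h, hfh, hdata, hf, hh⟩ :=
    hext e (cov e g 0) (-cov e g (N.len e)) (-h2Val _ g 0) (h2Val _ g (N.len e))
  set S := edgeBoundaryNorm e g with hSdef
  have hperm : ‖cov e g 0‖ + ‖-cov e g (N.len e)‖ + ‖-h2Val _ g 0‖ + ‖h2Val _ g (N.len e)‖ = S := by
    rw [hSdef, edgeBoundaryNorm, norm_neg, norm_neg]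
    ring
  rw [hperm] at hf hh
  have hS : 0 ≤ S := by rw [hSdef, edgeBoundaryNorm]; positivity
  have hgreen : inner ℂ f k - inner ℂ h g
      = ((‖cov e g 0‖ ^ 2 + ‖h2Val _ g 0‖ ^ 2 + ‖cov e g (N.len e)‖ ^ 2
        + ‖h2Val _ g (N.len e)‖ ^ 2 : ℝ) : ℂ) := by
    rw [hfh.green hg, boundaryForm, boundaryForm, hdata.left, hdata.right, hdata.cov_left,
      hdata.cov_right]
    simp only [inner_neg_left, inner_self_eq_norm_sq_to_K, Complex.coe_algebraMap]
    push_cast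
    ring
  have hsq : S * S ≤ S * (4 * K * (‖g‖ + ‖k‖)) := by
    calc S * S ≤ 4 * (‖cov e g 0‖ ^ 2 + ‖h2Val _ g 0‖ ^ 2 + ‖cov e g (N.len e)‖ ^ 2
            + ‖h2Val _ g (N.len e)‖ ^ 2) := by
          rw [← hperm, ← sq, ← norm_neg (h2Val _ g 0), ← norm_neg (cov e g (N.len e))]
          exact (sq_add_four_le _ _ _ _).trans_eq (by ring)
      _ = 4 * ‖inner ℂ f k - inner ℂ h g‖ := by
          rw [hgreen, Complex.norm_of_nonneg (by positivity)]
      _ ≤ 4 * (‖f‖ * ‖k‖ + ‖h‖ * ‖g‖) := by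
          gcongr
          exact (norm_sub_le _ _).trans
            (add_le_add (norm_inner_le_norm _ _) (norm_inner_le_norm _ _))
      _ ≤ 4 * (K * S * ‖k‖ + K * S * ‖g‖) := by gcongr
      _ = S * (4 * K * (‖g‖ + ‖k‖)) := by ring
  rcases hS.eq_or_lt with hS | hS
  · rw [← hS]
    positivity
  · exact le_of_mul_le_mul_left hsq hS

end RashbaNetwork

/-! ### Boundary triples and self-adjoint extensions -/

section Extensions

variable {H : Type*} [NormedAddCommGroup H] [InnerProductSpace ℂ H] {S T : H →ₗ.[ℂ] H}

theorem mem_graph_domRestrict_iff {D : Submodule ℂ H} {g k : H} :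
    (g, k) ∈ (T.domRestrict D).graph ↔ ∃ f : T.domain, (f : H) ∈ D ∧ (f : H) = g ∧ T f = k := by
  rw [LinearPMap.mem_graph_iff]
  constructor
  · rintro ⟨f, rfl, rfl⟩
    exact ⟨⟨f, f.2.2⟩, f.2.1, rfl, (LinearPMap.domRestrict_apply rfl).symm⟩
  · rintro ⟨f, hf, rfl, rfl⟩
    exact ⟨⟨f, hf, f.2⟩, rfl, LinearPMap.domRestrict_apply rfl⟩

theorem mem_adjoint_graph_domRestrict_iff {D : Submodule ℂ H} {g k : H} :
    (g, k) ∈ (T.domRestrict D).graph.adjoint ↔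
      ∀ f : T.domain, (f : H) ∈ D → inner ℂ (f : H) k = inner ℂ (T f) g := by
  simp only [Submodule.mem_adjoint_iff, mem_graph_domRestrict_iff, sub_eq_zero]
  constructor
  · exact fun h f hf => (h f (T f) ⟨f, hf, rfl, rfl⟩).symm
  · rintro h _ _ ⟨f, hf, rfl, rfl⟩
    exact (h f hf).symm

variable [CompleteSpace H]

theorem dense_domain_of_adjoint_graph_le (h : S.graph.adjoint ≤ T.graph) :
    Dense (S.domain : Set H) := by
  rw [Submodule.dense_iff_topologicalClosure_eq_top, Submodule.topologicalClosure_eq_top_iff,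
    Submodule.eq_bot_iff]
  intro k hk
  have hmem : ((0 : H), k) ∈ S.graph.adjoint := by
    refine (Submodule.mem_adjoint_iff _ _).2 fun a b hab => ?_
    rw [inner_zero_right, zero_sub, neg_eq_zero]
    exact (Submodule.mem_orthogonal _ _).1 hk _ (LinearPMap.mem_domain_of_mem_graph hab)
  exact T.graph_fst_eq_zero_snd (h hmem) rfl

theorem adjoint_eq_of_adjoint_graph_eq (h : S.graph.adjoint = T.graph) : S.adjoint = T :=
  LinearPMap.eq_of_eq_graph <|
    (LinearPMap.adjoint_graph_eq_graph_adjoint (dense_domain_of_adjoint_graph_le h.le)).trans h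

theorem isClosed_of_adjoint_graph_eq (h : S.graph.adjoint = T.graph) : T.IsClosed :=
  adjoint_eq_of_adjoint_graph_eq h ▸
    LinearPMap.adjoint_isClosed (dense_domain_of_adjoint_graph_le h.le)

end Extensions

section BoundaryTriple

variable {H G : Type*} [NormedAddCommGroup H] [InnerProductSpace ℂ H] [NormedAddCommGroup G]
  [InnerProductSpace ℂ G] {T : H →ₗ.[ℂ] H} {Γ Γ' : T.domain →ₗ[ℂ] G}

/-- The domain of the minimal operator of a boundary triple: the vectors in the domain of `T` both
of whose boundary values vanish. -/
def minimalDomain (Γ Γ' : T.domain →ₗ[ℂ] G) : Submodule ℂ H :=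
  Submodule.map T.domain.subtype (LinearMap.ker Γ ⊓ LinearMap.ker Γ')

theorem coe_mem_minimalDomain {f : T.domain} :
    (f : H) ∈ minimalDomain Γ Γ' ↔ Γ f = 0 ∧ Γ' f = 0 := by
  rw [minimalDomain, ← Submodule.subtype_apply, Submodule.mem_map]
  simp only [Submodule.subtype_apply, SetLike.coe_eq_coe, exists_eq_right, Submodule.mem_inf,
    LinearMap.mem_ker]

variable [CompleteSpace H]

theorem isBoundaryTriple_of_adjoint_graph_le
    (hgreen : ∀ f g : T.domain, inner ℂ (f : H) (T g) - inner ℂ (T f) (g : H)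
      = inner ℂ (Γ f) (Γ' g) - inner ℂ (Γ' f) (Γ g))
    (hsurj : Function.Surjective fun f : T.domain => (Γ f, Γ' f))
    (hmax : (T.domRestrict (minimalDomain Γ Γ')).graph.adjoint ≤ T.graph) :
    IsBoundaryTriple T Γ Γ' where
  closed := by
    refine isClosed_of_adjoint_graph_eq (le_antisymm hmax ?_)
    rintro ⟨_, _⟩ hgk
    obtain ⟨g, rfl, rfl⟩ := (LinearPMap.mem_graph_iff _).1 hgk
    refine mem_adjoint_graph_domRestrict_iff.2 fun f hf => ?_
    obtain ⟨hΓ, hΓ'⟩ := coe_mem_minimalDomain.1 hf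
    rw [← sub_eq_zero, hgreen, hΓ, hΓ', inner_zero_left, inner_zero_left, sub_zero]
  green := hgreen
  surjective := hsurj
  dense_ker := (dense_domain_of_adjoint_graph_le hmax).mono fun x hx =>
    ⟨⟨x, hx.2⟩, rfl, coe_mem_minimalDomain.1 hx.1⟩

theorem IsBoundaryTriple.isSelfAdjoint_domRestrict (hT : IsBoundaryTriple T Γ Γ')
    (hmax : (T.domRestrict (minimalDomain Γ Γ')).graph.adjoint ≤ T.graph)
    {Λ : Submodule ℂ (G × G)} (hΛ : Λ.adjoint = Λ) {D : Submodule ℂ H}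
    (hD : ∀ f : T.domain, (f : H) ∈ D ↔ (Γ f, Γ' f) ∈ Λ) : IsSelfAdjoint (T.domRestrict D) := by
  have hsymm : ∀ f g : T.domain, inner ℂ (f : H) (T g) = inner ℂ (T f) (g : H) ↔
      inner ℂ (Γ' f) (Γ g) - inner ℂ (Γ f) (Γ' g) = 0 := fun f g => by
    rw [← sub_eq_zero, hT.green, sub_eq_zero, sub_eq_zero, eq_comm]
  have hdom : ∀ g : T.domain, (g : H) ∈ D ↔
      ∀ f : T.domain, (f : H) ∈ D → inner ℂ (f : H) (T g) = inner ℂ (T f) (g : H) := fun g => by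
    rw [hD, ← hΛ, Submodule.mem_adjoint_iff]
    refine ⟨fun h f hf => (hsymm f g).2 (h _ _ ((hD f).1 hf)), fun h a b hab => ?_⟩
    obtain ⟨f, hf⟩ := hT.surjective (a, b)
    obtain ⟨rfl, rfl⟩ := Prod.ext_iff.1 hf
    exact (hsymm f g).1 (h f ((hD f).2 hab))
  refine LinearPMap.isSelfAdjoint_def.2 (adjoint_eq_of_adjoint_graph_eq ?_)
  ext ⟨g, k⟩
  rw [mem_adjoint_graph_domRestrict_iff, mem_graph_domRestrict_iff]
  constructor
  · intro h
    have hgraph : (g, k) ∈ T.graph := hmax <| mem_adjoint_graph_domRestrict_iff.2 fun f hf =>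
      h f <| (hD f).2 <| by
        obtain ⟨hΓ, hΓ'⟩ := coe_mem_minimalDomain.1 hf
        rw [hΓ, hΓ']
        exact Λ.zero_mem
    obtain ⟨g, rfl, rfl⟩ := (LinearPMap.mem_graph_iff _).1 hgraph
    exact ⟨g, (hdom g).2 h, rfl, rfl⟩
  · rintro ⟨g, hg, rfl, rfl⟩
    exact (hdom g).1 hg

end BoundaryTriple

section MultiplicationGraph

variable {ι : Type*} {E : ι → Type*} [∀ i, NormedAddCommGroup (E i)]
  [∀ i, InnerProductSpace ℂ (E i)]

variable (E) in
/-- The graph in `ℓ²` of the (possibly unbounded) operator of multiplication by `ε`. -/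
def multiplicationGraph (ε : ι → ℝ) : Submodule ℂ (lp E 2 × lp E 2) where
  carrier := {p | ∀ i, p.2 i = (ε i : ℂ) • p.1 i}
  add_mem' hp hq i := by
    simp only [Prod.fst_add, Prod.snd_add, lp.coeFn_add, Pi.add_apply, hp i, hq i, smul_add]
  zero_mem' i := by
    simp only [Prod.fst_zero, Prod.snd_zero, lp.coeFn_zero, Pi.zero_apply, smul_zero]
  smul_mem' c p hp i := by
    simp only [Prod.smul_fst, Prod.smul_snd, lp.coeFn_smul, Pi.smul_apply, hp i, smul_comm c]

theorem mem_multiplicationGraph {ε : ι → ℝ} {p : lp E 2 × lp E 2} :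
    p ∈ multiplicationGraph E ε ↔ ∀ i, p.2 i = (ε i : ℂ) • p.1 i := Iff.rfl

theorem adjoint_multiplicationGraph (ε : ι → ℝ) :
    (multiplicationGraph E ε).adjoint = multiplicationGraph E ε := by
  classical
  ext ⟨φ, ψ⟩
  simp only [Submodule.mem_adjoint_iff, sub_eq_zero, mem_multiplicationGraph]
  constructor
  · intro h i
    refine ext_inner_left ℂ fun w => ?_
    have htest := h (lp.single 2 i w) (lp.single 2 i ((ε i : ℂ) • w)) fun j => by
      exact (Pi.apply_single (fun j x => (ε j : ℂ) • x) (fun _ => smul_zero _) i w j).symm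
    rw [lp.inner_single_left, lp.inner_single_left, inner_smul_left, Complex.conj_ofReal] at htest
    rw [← htest, inner_smul_right]
  · intro h a b hab
    rw [lp.inner_eq_tsum, lp.inner_eq_tsum]
    refine tsum_congr fun i => ?_
    rw [hab i, h i, inner_smul_left, inner_smul_right, Complex.conj_ofReal]

end MultiplicationGraph

/-! ### Square summable families over finite fibres -/

section Fiber

variable {ι κ : Type*}

theorem memℓp_two_iff_summable_norm_sq {E : ι → Type*} [∀ i, NormedAddCommGroup (E i)]
    {f : ∀ i, E i} : Memℓp f 2 ↔ Summable fun i => ‖f i‖ ^ 2 := by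
  rw [memℓp_gen_iff (by norm_num)]
  simp only [ENNReal.toReal_ofNat, Real.rpow_ofNat]

variable {p : ι → κ} {s : κ → Finset ι}

theorem hasSum_sum_fiber {E : Type*} [NormedAddCommGroup E]
    (hs : ∀ {v i}, i ∈ s v ↔ p i = v) {F : ι → E} {a : E} (h : HasSum F a) :
    HasSum (fun v => ∑ i ∈ s v, F i) a := by
  refine ((Equiv.sigmaFiberEquiv p).hasSum_iff.2 h).sigma fun v => ?_
  have : Fintype {i // p i = v} := Fintype.subtype (s v) fun _ => hs
  rw [Finset.sum_subtype (s v) fun _ => hs]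
  exact hasSum_fintype _

theorem memℓp_two_sum_fiber {E : Type*} [NormedAddCommGroup E]
    (hs : ∀ {v i}, i ∈ s v ↔ p i = v) {M : ℕ} (hM : ∀ v, (s v).card ≤ M) {F : ι → E}
    (hF : Memℓp F 2) : Memℓp (fun v => ∑ i ∈ s v, F i) 2 := by
  have hfiber := (hasSum_sum_fiber hs (memℓp_two_iff_summable_norm_sq.1 hF).hasSum).summable
  refine memℓp_two_iff_summable_norm_sq.2 <|
    (hfiber.mul_left (M : ℝ)).of_nonneg_of_le (fun v => sq_nonneg _) fun v => ?_
  calc ‖∑ i ∈ s v, F i‖ ^ 2 ≤ (∑ i ∈ s v, ‖F i‖) ^ 2 := by gcongr; exact norm_sum_le _ _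
    _ ≤ (s v).card * ∑ i ∈ s v, ‖F i‖ ^ 2 := sq_sum_le_card_mul_sum_sq
    _ ≤ M * ∑ i ∈ s v, ‖F i‖ ^ 2 := by gcongr; exact hM v

theorem memℓp_two_comp {E : κ → Type*} [∀ v, NormedAddCommGroup (E v)]
    (hs : ∀ {v i}, i ∈ s v ↔ p i = v) {M : ℕ} (hM : ∀ v, (s v).card ≤ M) {φ : ∀ v, E v}
    (hφ : Memℓp φ 2) : Memℓp (fun i => φ (p i)) 2 := by
  classical
  have hsum := (memℓp_two_iff_summable_norm_sq.1 hφ).mul_left (M : ℝ)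
  refine memℓp_two_iff_summable_norm_sq.2 <|
    summable_of_sum_le (c := ∑' v, (M : ℝ) * ‖φ v‖ ^ 2) (fun _ => sq_nonneg _) fun t => ?_
  calc ∑ i ∈ t, ‖φ (p i)‖ ^ 2
      = ∑ v ∈ t.image p, (t.filter fun i => p i = v).card • ‖φ v‖ ^ 2 :=
        Finset.sum_comp (fun v => ‖φ v‖ ^ 2) p
    _ ≤ ∑ v ∈ t.image p, (M : ℝ) * ‖φ v‖ ^ 2 := by
        gcongr with v
        rw [nsmul_eq_mul]
        gcongr
        exact (Finset.card_le_card fun i hi => hs.2 (Finset.mem_filter.1 hi).2).trans (hM v)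
    _ ≤ ∑' v, (M : ℝ) * ‖φ v‖ ^ 2 := hsum.sum_le_tsum _ fun _ _ => by positivity

end Fiber

/-! ### Node values and node derivatives -/

namespace RashbaNetwork

section Nodes

variable (N : RashbaNetwork)

/-- The finite set of edges that start at the node `v`. -/
def outEdges (v : N.vert) : Finset N.edge := (finite_src v).toFinset

/-- The finite set of edges that end at the node `v`. -/
def inEdges (v : N.vert) : Finset N.edge := (finite_tgt v).toFinset

/-- The degree of a node: the number of edges that start or end there. -/
def degree (v : N.vert) : ℕ := (N.inEdges v).card + (N.outEdges v).card

variable {N}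

theorem mem_outEdges {v : N.vert} {e : N.edge} : e ∈ N.outEdges v ↔ N.src e = v := by
  rw [outEdges, Finite.mem_toFinset, mem_ofPred_eq]

theorem mem_inEdges {v : N.vert} {e : N.edge} : e ∈ N.inEdges v ↔ N.tgt e = v := by
  rw [inEdges, Finite.mem_toFinset, mem_ofPred_eq]

theorem card_outEdges (v : N.vert) :
    ((N.outEdges v).card : ℕ∞) = {w | (v.1, w) ∈ N.edge}.encard := by
  have himage : (fun e : N.edge => e.1.2) '' N.outEdges v = {w | (v.1, w) ∈ N.edge} := by
    ext w
    constructor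
    · rintro ⟨e, he, rfl⟩
      obtain rfl := mem_outEdges.1 he
      exact e.2
    · exact fun hw => ⟨⟨(v.1, w), hw⟩, mem_outEdges.2 rfl, rfl⟩
  rw [← encard_coe_eq_coe_finsetCard, ← himage, InjOn.encard_image]
  exact fun e he e' he' h => Subtype.ext <| Prod.ext
    (congrArg Subtype.val ((mem_outEdges.1 he).trans (mem_outEdges.1 he').symm)) h

theorem card_inEdges (v : N.vert) :
    ((N.inEdges v).card : ℕ∞) = {w | (w, v.1) ∈ N.edge}.encard := by
  have himage : (fun e : N.edge => e.1.1) '' N.inEdges v = {w | (w, v.1) ∈ N.edge} := by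
    ext w
    constructor
    · rintro ⟨e, he, rfl⟩
      obtain rfl := mem_inEdges.1 he
      exact e.2
    · exact fun hw => ⟨⟨(w, v.1), hw⟩, mem_inEdges.2 rfl, rfl⟩
  rw [← encard_coe_eq_coe_finsetCard, ← himage, InjOn.encard_image]
  exact fun e he e' he' h => Subtype.ext <| Prod.ext h
    (congrArg Subtype.val ((mem_inEdges.1 he).trans (mem_inEdges.1 he').symm))

variable (N) in
theorem exists_degree_bounds : ∃ M : ℕ, ∀ v, 1 ≤ N.degree v ∧ N.degree v ≤ M := by
  obtain ⟨M, hM⟩ := N.degree_bound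
  refine ⟨M, fun v => ?_⟩
  have hv := hM v v.2
  rw [← card_inEdges, ← card_outEdges] at hv
  exact_mod_cast hv

theorem degree_pos (v : N.vert) : 0 < N.degree v := by
  obtain ⟨_, hM⟩ := N.exists_degree_bounds
  exact (hM v).1

variable (N) in
theorem exists_card_le :
    ∃ M : ℕ, (∀ v, (N.outEdges v).card ≤ M) ∧ ∀ v, (N.inEdges v).card ≤ M := by
  obtain ⟨M, hM⟩ := N.exists_degree_bounds
  exact ⟨M, fun v => (Nat.le_add_left _ _).trans (hM v).2,
    fun v => (Nat.le_add_right _ _).trans (hM v).2⟩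

theorem isEdgePair_maxOp (f : N.dom) (e : N.edge) :
    IsEdgePair e ((f : N.StateSpace) e) (N.maxOp f e) :=
  ⟨f.2.isH2 e, N.maxOp_spec f e⟩

theorem memDomain_of_isEdgePair {f h : N.StateSpace} (hp : ∀ e, IsEdgePair e (f e) (h e))
    {φ : N.vert → Spin} (hφ : N.IsNodeValues f φ) : N.MemDomain f :=
  ⟨fun e => (hp e).isH2, ⟨h, fun e => (hp e).image⟩, ⟨φ, hφ⟩⟩

theorem maxOp_eq_of_isEdgePair {f : N.dom} {h : N.StateSpace}
    (hp : ∀ e, IsEdgePair e ((f : N.StateSpace) e) (h e)) : N.maxOp f = h :=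
  state_ext (N.maxOp_spec f) fun e => (hp e).image

theorem nodeVal_eq {f : N.dom} {φ : N.vert → Spin} (hφ : N.IsNodeValues f φ) :
    N.nodeVal f = φ := (N.nodeVal_spec f).unique hφ

theorem nodeDeriv_apply (f : N.dom) (v : N.vert) :
    N.nodeDeriv f v = ∑ e ∈ N.outEdges v, cov e ((f : N.StateSpace) e) 0
      - ∑ e ∈ N.inEdges v, cov e ((f : N.StateSpace) e) (N.len e) :=
  congrArg₂ (fun x y : Spin => x - y) (finsum_mem_eq_finite_toFinset_sum _ (finite_src v))
    (finsum_mem_eq_finite_toFinset_sum _ (finite_tgt v))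

theorem degree_smul_nodeVal (f : N.dom) (v : N.vert) :
    N.degree v • N.nodeVal f v = ∑ e ∈ N.inEdges v, h2Val _ ((f : N.StateSpace) e) (N.len e)
      + ∑ e ∈ N.outEdges v, h2Val _ ((f : N.StateSpace) e) 0 := by
  rw [degree, add_smul, ← Finset.sum_const, ← Finset.sum_const]
  congr 1 <;> refine Finset.sum_congr rfl fun e he => ?_
  · rw [← mem_inEdges.1 he, (N.nodeVal_spec f e).2]
  · rw [← mem_outEdges.1 he, (N.nodeVal_spec f e).1]

theorem memℓp_edgeBoundaryNorm (f : N.dom) :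
    Memℓp (fun e => edgeBoundaryNorm e ((f : N.StateSpace) e)) 2 := by
  obtain ⟨K, hbound⟩ := N.exists_edgeBoundaryNorm_le
  have hsum := ((lp.memℓp (f : N.StateSpace)).norm.add (lp.memℓp (N.maxOp f)).norm).const_mul K
  refine hsum.mono fun e => ?_
  rw [Real.norm_of_nonneg (by rw [edgeBoundaryNorm]; positivity)]
  exact hbound e _ _ (isEdgePair_maxOp f e)

theorem memℓp_boundaryData (f : N.dom) :
    Memℓp (fun e => h2Val _ ((f : N.StateSpace) e) 0) 2 ∧
      Memℓp (fun e => h2Val _ ((f : N.StateSpace) e) (N.len e)) 2 ∧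
      Memℓp (fun e => cov e ((f : N.StateSpace) e) 0) 2 ∧
      Memℓp (fun e => cov e ((f : N.StateSpace) e) (N.len e)) 2 := by
  have hle : ∀ {x : N.edge → Spin}, (∀ e, ‖x e‖ ≤ edgeBoundaryNorm e ((f : N.StateSpace) e)) →
      Memℓp x 2 := (memℓp_edgeBoundaryNorm f).mono
  simp only [edgeBoundaryNorm] at hle
  refine ⟨hle fun e => ?_, hle fun e => ?_, hle fun e => ?_, hle fun e => ?_⟩ <;>
    linarith [norm_nonneg (h2Val _ ((f : N.StateSpace) e) 0),
      norm_nonneg (h2Val _ ((f : N.StateSpace) e) (N.len e)),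
      norm_nonneg (cov e ((f : N.StateSpace) e) 0),
      norm_nonneg (cov e ((f : N.StateSpace) e) (N.len e))]

theorem memℓp_nodeVal (f : N.dom) : Memℓp (N.nodeVal f) 2 := by
  obtain ⟨_, hout, hin⟩ := N.exists_card_le
  obtain ⟨hleft, hright, -, -⟩ := memℓp_boundaryData f
  have hsum := ((memℓp_two_sum_fiber mem_inEdges hin hright).add
    (memℓp_two_sum_fiber mem_outEdges hout hleft)).norm
  refine hsum.mono fun v => ?_
  rw [Pi.add_apply, ← degree_smul_nodeVal, RCLike.norm_nsmul ℂ,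
    nsmul_eq_mul]
  exact le_mul_of_one_le_left (norm_nonneg _) (Nat.one_le_cast.2 (degree_pos v))

theorem memℓp_nodeDeriv (f : N.dom) : Memℓp (N.nodeDeriv f) 2 := by
  obtain ⟨_, hout, hin⟩ := N.exists_card_le
  obtain ⟨-, -, hleft, hright⟩ := memℓp_boundaryData f
  rw [funext (nodeDeriv_apply f)]
  exact (memℓp_two_sum_fiber mem_outEdges hout hleft).sub
    (memℓp_two_sum_fiber mem_inEdges hin hright)

variable (N) in
/-- The boundary map `Γ` with values in `ℓ²(V,ℂ²)`. -/
def nodeValL2 : N.maxOp.domain →ₗ[ℂ] N.NodeSpace where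
  toFun f := ⟨N.nodeVal f, memℓp_nodeVal f⟩
  map_add' f g := Subtype.ext (N.nodeVal.map_add f g)
  map_smul' c f := Subtype.ext (N.nodeVal.map_smul c f)

variable (N) in
/-- The boundary map `Γ'` with values in `ℓ²(V,ℂ²)`. -/
def nodeDerivL2 : N.maxOp.domain →ₗ[ℂ] N.NodeSpace where
  toFun f := ⟨N.nodeDeriv f, memℓp_nodeDeriv f⟩
  map_add' f g := Subtype.ext (N.nodeDeriv.map_add f g)
  map_smul' c f := Subtype.ext (N.nodeDeriv.map_smul c f)

theorem summable_boundaryForm (f g : N.dom) :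
    (Summable fun e => boundaryForm e ((f : N.StateSpace) e) ((g : N.StateSpace) e) 0) ∧
      Summable fun e => boundaryForm e ((f : N.StateSpace) e) ((g : N.StateSpace) e) (N.len e) := by
  have hinner : ∀ {x y : N.edge → Spin}, Memℓp x 2 → Memℓp y 2 →
      Summable fun e => inner ℂ (x e) (y e) := fun hx hy => lp.summable_inner ⟨_, hx⟩ ⟨_, hy⟩
  obtain ⟨hf₀, hf₁, hf₀', hf₁'⟩ := memℓp_boundaryData f
  obtain ⟨hg₀, hg₁, hg₀', hg₁'⟩ := memℓp_boundaryData g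
  exact ⟨(hinner hf₀ hg₀').sub (hinner hf₀' hg₀), (hinner hf₁ hg₁').sub (hinner hf₁' hg₁)⟩

theorem sum_outEdges_boundaryForm (f g : N.dom) (v : N.vert) :
    ∑ e ∈ N.outEdges v, boundaryForm e ((f : N.StateSpace) e) ((g : N.StateSpace) e) 0
      = inner ℂ (N.nodeVal f v) (∑ e ∈ N.outEdges v, cov e ((g : N.StateSpace) e) 0)
        - inner ℂ (∑ e ∈ N.outEdges v, cov e ((f : N.StateSpace) e) 0) (N.nodeVal g v) := by
  rw [inner_sum, sum_inner, ← Finset.sum_sub_distrib]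
  refine Finset.sum_congr rfl fun e he => ?_
  rw [boundaryForm, (N.nodeVal_spec f e).1, (N.nodeVal_spec g e).1, mem_outEdges.1 he]

theorem sum_inEdges_boundaryForm (f g : N.dom) (v : N.vert) :
    ∑ e ∈ N.inEdges v, boundaryForm e ((f : N.StateSpace) e) ((g : N.StateSpace) e) (N.len e)
      = inner ℂ (N.nodeVal f v) (∑ e ∈ N.inEdges v, cov e ((g : N.StateSpace) e) (N.len e))
        - inner ℂ (∑ e ∈ N.inEdges v, cov e ((f : N.StateSpace) e) (N.len e))
          (N.nodeVal g v) := by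
  rw [inner_sum, sum_inner, ← Finset.sum_sub_distrib]
  refine Finset.sum_congr rfl fun e he => ?_
  rw [boundaryForm, (N.nodeVal_spec f e).2, (N.nodeVal_spec g e).2, mem_inEdges.1 he]

theorem sum_boundaryForm (f g : N.dom) (v : N.vert) :
    ∑ e ∈ N.outEdges v, boundaryForm e ((f : N.StateSpace) e) ((g : N.StateSpace) e) 0
      - ∑ e ∈ N.inEdges v, boundaryForm e ((f : N.StateSpace) e) ((g : N.StateSpace) e) (N.len e)
      = inner ℂ (N.nodeVal f v) (N.nodeDeriv g v)
        - inner ℂ (N.nodeDeriv f v) (N.nodeVal g v) := by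
  rw [sum_outEdges_boundaryForm, sum_inEdges_boundaryForm, nodeDeriv_apply, nodeDeriv_apply,
    inner_sub_left, inner_sub_right]
  ring

theorem green_maxOp (f g : N.maxOp.domain) :
    inner ℂ (f : N.StateSpace) (N.maxOp g) - inner ℂ (N.maxOp f) (g : N.StateSpace)
      = inner ℂ (N.nodeValL2 f) (N.nodeDerivL2 g) - inner ℂ (N.nodeDerivL2 f) (N.nodeValL2 g) := by
  obtain ⟨hleft, hright⟩ := summable_boundaryForm (N := N) f g
  have hedges := ((lp.hasSum_inner (𝕜 := ℂ) (f : N.StateSpace) (N.maxOp g)).sub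
    (lp.hasSum_inner (𝕜 := ℂ) (N.maxOp f) (g : N.StateSpace))).congr_fun fun e =>
      ((isEdgePair_maxOp f e).green (isEdgePair_maxOp g e)).symm
  have hnodes := ((lp.hasSum_inner (𝕜 := ℂ) (N.nodeValL2 f) (N.nodeDerivL2 g)).sub
    (lp.hasSum_inner (𝕜 := ℂ) (N.nodeDerivL2 f) (N.nodeValL2 g))).congr_fun fun v =>
      sum_boundaryForm (N := N) f g v
  exact (hedges.unique (hleft.hasSum.sub hright.hasSum)).trans <|
    ((hasSum_sum_fiber mem_outEdges hleft.hasSum).sub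
      (hasSum_sum_fiber mem_inEdges hright.hasSum)).unique hnodes

end Nodes

end RashbaNetwork

namespace RashbaNetwork

section BoundaryValues

variable {N : RashbaNetwork}

theorem exists_isEdgePair_of_memℓp {x₀ x₁ y₀ y₁ : N.edge → Spin} (hx₀ : Memℓp x₀ 2)
    (hx₁ : Memℓp x₁ 2) (hy₀ : Memℓp y₀ 2) (hy₁ : Memℓp y₁ 2) :
    ∃ f h : N.StateSpace, ∀ e, IsEdgePair e (f e) (h e) ∧
      HasBoundaryData e (f e) (x₀ e) (x₁ e) (y₀ e) (y₁ e) := by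
  obtain ⟨K, _, hext⟩ := N.exists_extension
  choose f h hfh hdata hf hh using fun e => hext e (x₀ e) (x₁ e) (y₀ e) (y₁ e)
  have hbound := (((hx₀.norm.add hx₁.norm).add hy₀.norm).add hy₁.norm).const_mul K
  exact ⟨⟨f, hbound.mono hf⟩, ⟨h, hbound.mono hh⟩, fun e => ⟨hfh e, hdata e⟩⟩

theorem nodeDeriv_eq_degree_smul {f : N.dom} {χ : N.vert → Spin}
    (hleft : ∀ e, cov e ((f : N.StateSpace) e) 0 = χ (N.src e))
    (hright : ∀ e, cov e ((f : N.StateSpace) e) (N.len e) = -χ (N.tgt e)) (v : N.vert) :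
    N.nodeDeriv f v = N.degree v • χ v := by
  have hout : ∑ e ∈ N.outEdges v, cov e ((f : N.StateSpace) e) 0
      = ∑ _e ∈ N.outEdges v, χ v :=
    Finset.sum_congr rfl fun e he => by rw [hleft, mem_outEdges.1 he]
  have hin : ∑ e ∈ N.inEdges v, cov e ((f : N.StateSpace) e) (N.len e)
      = ∑ _e ∈ N.inEdges v, -χ v :=
    Finset.sum_congr rfl fun e he => by rw [hright, mem_inEdges.1 he]
  rw [nodeDeriv_apply, hout, hin, Finset.sum_const, Finset.sum_const, smul_neg, sub_neg_eq_add,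
    add_comm, ← add_smul, degree]

theorem memℓp_comp_src {φ : N.vert → Spin} (hφ : Memℓp φ 2) : Memℓp (fun e => φ (N.src e)) 2 := by
  obtain ⟨_, hout, -⟩ := N.exists_card_le
  exact memℓp_two_comp mem_outEdges hout hφ

theorem memℓp_comp_tgt {φ : N.vert → Spin} (hφ : Memℓp φ 2) : Memℓp (fun e => φ (N.tgt e)) 2 := by
  obtain ⟨_, -, hin⟩ := N.exists_card_le
  exact memℓp_two_comp mem_inEdges hin hφ

theorem exists_dom_nodeVal_nodeDeriv {φ χ : N.vert → Spin} (hφ : Memℓp φ 2) (hχ : Memℓp χ 2) :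
    ∃ f : N.dom, N.nodeVal f = φ ∧ ∀ v, N.nodeDeriv f v = N.degree v • χ v := by
  obtain ⟨f, h, hfh⟩ := exists_isEdgePair_of_memℓp (memℓp_comp_src hφ) (memℓp_comp_tgt hφ)
    (memℓp_comp_src hχ) (memℓp_comp_tgt hχ).neg
  have hval : N.IsNodeValues f φ := fun e => ⟨(hfh e).2.left, (hfh e).2.right⟩
  exact ⟨⟨f, memDomain_of_isEdgePair (fun e => (hfh e).1) hval⟩, nodeVal_eq hval,
    nodeDeriv_eq_degree_smul (fun e => (hfh e).2.cov_left) fun e => (hfh e).2.cov_right⟩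

theorem memℓp_inv_degree_smul {ψ : N.vert → Spin} (hψ : Memℓp ψ 2) :
    Memℓp (fun v => (N.degree v : ℂ)⁻¹ • ψ v) 2 := by
  refine hψ.norm.mono fun v => ?_
  rw [norm_smul, norm_inv, Complex.norm_natCast]
  exact mul_le_of_le_one_left (norm_nonneg _)
    (inv_le_one_of_one_le₀ (Nat.one_le_cast.2 (degree_pos v)))

theorem surjective_boundaryMaps :
    Function.Surjective fun f : N.maxOp.domain => (N.nodeValL2 f, N.nodeDerivL2 f) := by
  rintro ⟨φ, ψ⟩
  -- The prescribed node derivative is distributed evenly over the edges at the node.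
  obtain ⟨f, hval, hderiv⟩ :=
    exists_dom_nodeVal_nodeDeriv (lp.memℓp φ) (memℓp_inv_degree_smul (lp.memℓp ψ))
  refine ⟨f, Prod.ext (Subtype.ext hval) (Subtype.ext (funext fun v => (hderiv v).trans ?_))⟩
  rw [← Nat.cast_smul_eq_nsmul ℂ, smul_inv_smul₀ (Nat.cast_ne_zero.2 (degree_pos v).ne')]

end BoundaryValues

/-! ### Test functions supported on one edge -/

section TestFunctions

variable {N : RashbaNetwork} {e : N.edge}

theorem isEdgePair_zero (e : N.edge) : IsEdgePair e 0 0 := by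
  have h := isEdgePair_maxOp (0 : N.dom) e
  rwa [show N.maxOp (0 : N.dom) = 0 from N.maxOp.map_zero] at h

theorem hasBoundaryData_zero (e : N.edge) : HasBoundaryData e 0 0 0 0 0 := by
  obtain ⟨hleft, hright⟩ := N.nodeVal_spec 0 e
  have hcov := edgeCov_smul (f := (0 : N.StateSpace)) 0 e (isEdgePair_zero e).isH2
  rw [zero_smul] at hcov
  rw [map_zero] at hleft hright
  exact ⟨hleft, hright, (hcov 0 (left_mem_Icc.2 (N.len_pos e).le)).trans (zero_smul _ _),
    (hcov _ (right_mem_Icc.2 (N.len_pos e).le)).trans (zero_smul _ _)⟩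

theorem isEdgePair_single [DecidableEq N.edge] {f h : SegL2 (N.len e)} (hfh : IsEdgePair e f h)
    (e' : N.edge) : IsEdgePair e' ((lp.single 2 e f : N.StateSpace) e')
      ((lp.single 2 e h : N.StateSpace) e') := by
  obtain rfl | he := eq_or_ne e' e
  · rwa [lp.single_apply_self, lp.single_apply_self]
  · rw [lp.single_apply_ne _ _ _ he, lp.single_apply_ne _ _ _ he]
    exact isEdgePair_zero e'

theorem hasBoundaryData_single [DecidableEq N.edge] {f : SegL2 (N.len e)} {x₀ x₁ y₀ y₁ : Spin}
    (hdata : HasBoundaryData e f x₀ x₁ y₀ y₁) (e' : N.edge) :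
    HasBoundaryData e' ((lp.single 2 e f : N.StateSpace) e')
      ((Pi.single e x₀ : N.edge → Spin) e') ((Pi.single e x₁ : N.edge → Spin) e')
      ((Pi.single e y₀ : N.edge → Spin) e') ((Pi.single e y₁ : N.edge → Spin) e') := by
  obtain rfl | he := eq_or_ne e' e
  · simpa only [lp.single_apply_self, Pi.single_eq_same] using hdata
  · simpa only [lp.single_apply_ne _ _ _ he, Pi.single_eq_of_ne he] using hasBoundaryData_zero e'

theorem exists_dom_single [DecidableEq N.edge] [DecidableEq N.vert] {f h : SegL2 (N.len e)}
    (hfh : IsEdgePair e f h) {y₀ y₁ : Spin} (hdata : HasBoundaryData e f 0 0 y₀ y₁) :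
    ∃ F : N.dom, (F : N.StateSpace) = lp.single 2 e f ∧ N.maxOp F = lp.single 2 e h ∧
      N.nodeVal F = 0 ∧ N.nodeDeriv F = Pi.single (N.src e) y₀ - Pi.single (N.tgt e) y₁ := by
  have hsingle := hasBoundaryData_single hdata
  have hval : N.IsNodeValues (lp.single 2 e f : N.StateSpace) 0 := fun e' =>
    ⟨(hsingle e').left.trans (by rw [Pi.single_zero, Pi.zero_apply, Pi.zero_apply]),
      (hsingle e').right.trans (by rw [Pi.single_zero, Pi.zero_apply, Pi.zero_apply])⟩
  refine ⟨⟨lp.single 2 e f, memDomain_of_isEdgePair (isEdgePair_single hfh) hval⟩, rfl,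
    maxOp_eq_of_isEdgePair (isEdgePair_single hfh), nodeVal_eq hval, funext fun v => ?_⟩
  rw [nodeDeriv_apply, Finset.sum_congr rfl fun e' _ => (hsingle e').cov_left,
    Finset.sum_congr rfl fun e' _ => (hsingle e').cov_right, Finset.sum_pi_single',
    Finset.sum_pi_single']
  simp only [Pi.sub_apply, Pi.single_apply, mem_outEdges, mem_inEdges, eq_comm]

theorem inner_single_sub_inner_single [DecidableEq N.edge] {f h : SegL2 (N.len e)}
    (hfh : IsEdgePair e f h) {y₀ y₁ : Spin} (hdata : HasBoundaryData e f 0 0 y₀ y₁)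
    {g k : N.StateSpace} (hgk : IsEdgePair e (g e) (k e)) :
    inner ℂ (lp.single 2 e f : N.StateSpace) k - inner ℂ (lp.single 2 e h : N.StateSpace) g
      = inner ℂ y₁ (h2Val _ (g e) (N.len e)) - inner ℂ y₀ (h2Val _ (g e) 0) := by
  rw [lp.inner_single_left, lp.inner_single_left, hfh.green hgk, boundaryForm, boundaryForm,
    hdata.left, hdata.right, hdata.cov_left, hdata.cov_right, inner_zero_left, inner_zero_left]
  ring

/-- `z` is the value at the node `v` of the component of `g` on some edge that starts or ends
there. -/
def IsEndValue (g : N.StateSpace) (v : N.vert) (z : Spin) : Prop :=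
  (∃ e, N.src e = v ∧ h2Val _ (g e) 0 = z) ∨ ∃ e, N.tgt e = v ∧ h2Val _ (g e) (N.len e) = z

theorem exists_isEndValue (g : N.StateSpace) (v : N.vert) : ∃ z, IsEndValue g v z := by
  rcases Nat.add_pos_iff_pos_or_pos.1 (degree_pos v) with h | h
  · obtain ⟨e, he⟩ := Finset.card_pos.1 h
    exact ⟨_, .inr ⟨e, mem_inEdges.1 he, rfl⟩⟩
  · obtain ⟨e, he⟩ := Finset.card_pos.1 h
    exact ⟨_, .inl ⟨e, mem_outEdges.1 he, rfl⟩⟩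

theorem IsEndValue.exists_test_function [DecidableEq N.vert] {g k : N.StateSpace}
    (hgk : ∀ e, IsEdgePair e (g e) (k e)) {v : N.vert} {z : Spin} (hz : IsEndValue g v z)
    (w : Spin) : ∃ F : N.dom, N.nodeVal F = 0 ∧ N.nodeDeriv F = Pi.single v w ∧
      inner ℂ (F : N.StateSpace) k - inner ℂ (N.maxOp F) g = -inner ℂ w z := by
  classical
  obtain ⟨K, -, hext⟩ := N.exists_extension
  rcases hz with ⟨e, rfl, rfl⟩ | ⟨e, rfl, rfl⟩
  · obtain ⟨f, h, hfh, hdata, -, -⟩ := hext e 0 0 w 0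
    obtain ⟨F, hF, hop, hval, hderiv⟩ := exists_dom_single hfh hdata
    refine ⟨F, hval, by rw [hderiv, Pi.single_zero, sub_zero], ?_⟩
    rw [hF, hop, inner_single_sub_inner_single hfh hdata (hgk e), inner_zero_left, zero_sub]
  · obtain ⟨f, h, hfh, hdata, -, -⟩ := hext e 0 0 0 (-w)
    obtain ⟨F, hF, hop, hval, hderiv⟩ := exists_dom_single hfh hdata
    refine ⟨F, hval, by rw [hderiv, Pi.single_zero, zero_sub, Pi.single_neg, neg_neg], ?_⟩
    rw [hF, hop, inner_single_sub_inner_single hfh hdata (hgk e), inner_zero_left, sub_zero,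
      inner_neg_left]

end TestFunctions

/-! ### The boundary triple and the Hamiltonian -/

section Maximality

variable {N : RashbaNetwork}

/-- `Π F = k` holds weakly for `g` when tested against the functions in `𝒟` with vanishing boundary
values. -/
def IsWeakPair (g k : N.StateSpace) : Prop :=
  ∀ F : N.dom, N.nodeVal F = 0 → N.nodeDeriv F = 0 →
    inner ℂ (F : N.StateSpace) k = inner ℂ (N.maxOp F) g

theorem isWeakPair_of_mem_adjoint_graph {g k : N.StateSpace}
    (h : (g, k) ∈ (N.maxOp.domRestrict (minimalDomain N.nodeValL2 N.nodeDerivL2)).graph.adjoint) :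
    IsWeakPair g k := fun F hval hderiv =>
  mem_adjoint_graph_domRestrict_iff.1 h F <|
    coe_mem_minimalDomain.2 ⟨Subtype.ext hval, Subtype.ext hderiv⟩

theorem IsWeakPair.isEdgePair {g k : N.StateSpace} (hgk : IsWeakPair g k) (e : N.edge) :
    IsEdgePair e (g e) (k e) := by
  classical
  refine isEdgePair_of_weak_solution fun f h hfh hdata => ?_
  obtain ⟨F, hF, hop, hval, hderiv⟩ := exists_dom_single hfh hdata
  have hweak := hgk F hval (by rw [hderiv, Pi.single_zero, Pi.single_zero, sub_zero])
  rwa [hF, hop, lp.inner_single_left, lp.inner_single_left] at hweak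

theorem IsWeakPair.isEndValue_unique {g k : N.StateSpace} (hgk : IsWeakPair g k) {v : N.vert}
    {z z' : Spin} (hz : IsEndValue g v z) (hz' : IsEndValue g v z') : z = z' := by
  classical
  refine ext_inner_left ℂ fun w => ?_
  obtain ⟨F, hval, hderiv, hF⟩ := hz.exists_test_function hgk.isEdgePair w
  obtain ⟨F', hval', hderiv', hF'⟩ := hz'.exists_test_function hgk.isEdgePair w
  have hweak := hgk (F - F') (by rw [map_sub, hval, hval', sub_zero])
    (by rw [map_sub, hderiv, hderiv', sub_self])
  rw [show N.maxOp (F - F') = N.maxOp F - N.maxOp F' from N.maxOp.map_sub F F',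
    Submodule.coe_sub, inner_sub_left, inner_sub_left] at hweak
  linear_combination hF - hF' - hweak

theorem adjoint_graph_minimal_le :
    (N.maxOp.domRestrict (minimalDomain N.nodeValL2 N.nodeDerivL2)).graph.adjoint
      ≤ N.maxOp.graph := by
  rintro ⟨g, k⟩ h
  have hgk := isWeakPair_of_mem_adjoint_graph h
  choose φ hφ using exists_isEndValue g
  have hval : N.IsNodeValues g φ := fun e =>
    ⟨hgk.isEndValue_unique (.inl ⟨e, rfl, rfl⟩) (hφ _),
      hgk.isEndValue_unique (.inr ⟨e, rfl, rfl⟩) (hφ _)⟩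
  exact (LinearPMap.mem_graph_iff _).2
    ⟨⟨g, memDomain_of_isEdgePair hgk.isEdgePair hval⟩, rfl, maxOp_eq_of_isEdgePair hgk.isEdgePair⟩

theorem isBoundaryTriple : IsBoundaryTriple N.maxOp N.nodeValL2 N.nodeDerivL2 :=
  isBoundaryTriple_of_adjoint_graph_le green_maxOp surjective_boundaryMaps adjoint_graph_minimal_le

theorem coe_mem_hamiltonianDom {f : N.dom} :
    (f : N.StateSpace) ∈ N.hamiltonianDom ↔
      ∀ v, N.nodeDeriv f v = (N.eps v : ℂ) • N.nodeVal f v := by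
  constructor
  · rintro ⟨g, hg, hgf⟩
    obtain rfl : g = f := Subtype.ext hgf
    exact hg
  · exact fun hf => ⟨f, hf, rfl⟩

theorem isSelfAdjoint_hamiltonian : IsSelfAdjoint N.hamiltonian :=
  isBoundaryTriple.isSelfAdjoint_domRestrict adjoint_graph_minimal_le
    (adjoint_multiplicationGraph N.eps) fun _ => coe_mem_hamiltonianDom

end Maximality

end RashbaNetwork

end

theorem mainTheorem5 (N : RashbaNetwork) :
    N.maxOp.IsClosed ∧
    (∀ f : N.dom, Memℓp (N.nodeVal f) 2 ∧ Memℓp (N.nodeDeriv f) 2) ∧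
    (∃ Γ Γ' : N.maxOp.domain →ₗ[ℂ] N.NodeSpace,
      (∀ f v, Γ f v = N.nodeVal f v) ∧
      (∀ f v, Γ' f v = N.nodeDeriv f v) ∧
      IsBoundaryTriple N.maxOp Γ Γ') ∧
    IsSelfAdjoint N.hamiltonian :=
  ⟨RashbaNetwork.isBoundaryTriple.closed,
    fun f => ⟨RashbaNetwork.memℓp_nodeVal f, RashbaNetwork.memℓp_nodeDeriv f⟩,
    ⟨N.nodeValL2, N.nodeDerivL2, fun _ _ => rfl, fun _ _ => rfl, RashbaNetwork.isBoundaryTriple⟩,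
    RashbaNetwork.isSelfAdjoint_hamiltonian⟩
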